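/- Let $l,k\in\mathbb N$ with $l\ge 1$ and $1\le k\le 4l$, let $a>0$ and $0<L<\infty$. For real-valued $f\in L^2(0,L)$ consider the boundary value problem $$au+\sum_{j=1}^{l}(-1)^{j+1}D^{2j+1}u+u^kDu=f\quad\text{in }(0,L),$$ $$D^iu(0)=D^iu(L)=D^lu(L)=0,\qquad i=0,\dots,l-1.$$ A regular solution is a real-valued function $u\in H^{2l+1}(0,L)$ that satisfies the equation almost everywhere and the boundary conditions. Write $\|\cdot\|$ for the norm of $L^2(0,L)$ and $((1+x),f^2)=\int_0^L(1+x)f(x)^2\,dx$. Then there are positive constants $\delta$, $K$ and $C$, depending only on $a,L,l,k$, such that: 1. (Unique solvability) for every $f\in L^2(0,L)$ with $((1+x),f^2)<\delta$ the problem has exactly one regular solution $u$, and this solution satisfies $$\|u\|_{H^{2l+1}(0,L)}\le K\,((1+x),f^2)^{1/2};$$ 2. (Continuous dependence on $f$) if $f_1,f_2\in L^2(0,L)$ satisfy $((1+x),f_i^2)<\delta$ for $i=1,2$, and $u_1,u_2$ are the regular solutions with right-hand sides $f_1,f_2$, then $$\|u_1-u_2\|\le C\,\|f_1-f_2\|.$$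 -/

import Mathlib

open MeasureTheory

/-- The real space `L²(0,L)`; its norm is the usual one. -/
abbrev L2 (L : ℝ) : Type := Lp ℝ 2 (volume.restrict (Set.Ioo (0 : ℝ) L))

/-- `φ ∈ C_c^∞(0,L)`, extended by zero to the line. -/
structure IsTestFun (L : ℝ) (φ : ℝ → ℝ) : Prop where
  smooth : ContDiff ℝ (⊤ : ℕ∞) φ
  compact : HasCompactSupport φ
  supp : tsupport φ ⊆ Set.Ioo 0 L

/-- `v ∈ L²(0,L)` is the weak derivative of order `n` of `u ∈ L²(0,L)` on `(0,L)`. -/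
def IsWeakDeriv (L : ℝ) (n : ℕ) (u v : L2 L) : Prop :=
  ∀ φ : ℝ → ℝ, IsTestFun L φ →
    ∫ x in Set.Ioo 0 L, u x * iteratedDeriv n φ x
      = (-1) ^ n * ∫ x in Set.Ioo 0 L, v x * φ x

/-- Weak derivatives are unique. -/
theorem IsWeakDeriv.unique {L : ℝ} {n : ℕ} {u v w : L2 L}
    (hv : IsWeakDeriv L n u v) (hw : IsWeakDeriv L n u w) : v = w := by
  have hfin : IsFiniteMeasure (volume.restrict (Set.Ioo (0 : ℝ) L)) := inferInstance
  have hi : ∀ z : L2 L, IntegrableOn (fun x => z x) (Set.Ioo 0 L) := fun z =>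
    (Lp.memLp z).integrable (by norm_num)
  have key : ∀ᵐ x ∂volume, x ∈ Set.Ioo (0 : ℝ) L → v x - w x = 0 := by
    refine isOpen_Ioo.ae_eq_zero_of_integral_contDiff_smul_eq_zero
      (f := fun x => v x - w x) ?_ ?_
    · exact ((hi v).sub (hi w)).locallyIntegrableOn
    · intro g hg hgc hgs
      have h1 := (hv g ⟨hg, hgc, hgs⟩).symm.trans (hw g ⟨hg, hgc, hgs⟩)
      have h2 := mul_left_cancel₀ (pow_ne_zero n (by norm_num : (-1 : ℝ) ≠ 0)) h1
      obtain ⟨M, hM⟩ := hgc.exists_bound_of_continuous hg.continuous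
      have hint : ∀ z : L2 L, IntegrableOn (fun x => z x * g x) (Set.Ioo 0 L) := fun z =>
        (hi z).mul_bdd (c := M) hg.continuous.aestronglyMeasurable
          (Filter.Eventually.of_forall hM)
      have h3 : ∫ x in Set.Ioo 0 L, g x • (v x - w x) = 0 := by
        have : (fun x => g x • (v x - w x)) = fun x => v x * g x - w x * g x := by
          funext x; simp only [smul_eq_mul]; ring
        rw [this, integral_sub (hint v) (hint w), h2, sub_self]
      refine (setIntegral_eq_integral_of_forall_compl_eq_zero ?_).symm.trans h3
      intro x hx
      rw [image_eq_zero_of_notMem_tsupport (fun h => hx (hgs h)), zero_smul]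
  refine Lp.ext ?_
  filter_upwards [(ae_restrict_iff' measurableSet_Ioo).2 key] with x hx
  linarith

open Classical in
/-- `Dⁿu`, the weak derivative of order `n` of `u` in `L²(0,L)` (zero if there is none). -/
noncomputable def weakDeriv (L : ℝ) (n : ℕ) (u : L2 L) : L2 L :=
  if h : ∃ v, IsWeakDeriv L n u v then h.choose else 0

theorem IsWeakDeriv.weakDeriv_eq {L : ℝ} {n : ℕ} {u v : L2 L}
    (hv : IsWeakDeriv L n u v) : weakDeriv L n u = v := by
  have h : ∃ v, IsWeakDeriv L n u v := ⟨v, hv⟩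
  rw [weakDeriv, dif_pos h]
  exact h.choose_spec.unique hv

/-- `u ∈ H^m(0,L)`. -/
def MemH (L : ℝ) (m : ℕ) (u : L2 L) : Prop :=
  ∀ i ≤ m, ∃ v, IsWeakDeriv L i u v

/-- The norm of `H^m(0,L)`. -/
noncomputable def normH (L : ℝ) (m : ℕ) (u : L2 L) : ℝ :=
  Real.sqrt (∑ i ∈ Finset.range (m + 1), ‖weakDeriv L i u‖ ^ 2)

/-- `v` has a representative that is continuous on `[0,L]`, and this representative takes the
value `c` at `p`. -/
def HasValueAt (L : ℝ) (v : L2 L) (p c : ℝ) : Prop :=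
  ∃ g : ℝ → ℝ, ContinuousOn g (Set.Icc 0 L) ∧
    (∀ᵐ x ∂volume.restrict (Set.Ioo (0 : ℝ) L), v x = g x) ∧ g p = c

/-- `u` is a regular solution of the boundary value problem: `u ∈ H^{2l+1}(0,L)`, the equation
`a u + ∑_{j=1}^l (-1)^{j+1} D^{2j+1} u + u^k D u = f` holds almost everywhere in `(0,L)`, and
`D^i u(0) = D^i u(L) = D^l u(L) = 0` for `i = 0, …, l-1`. -/
structure IsRegularSolution (a L : ℝ) (l k : ℕ) (f u : L2 L) : Prop where
  mem : MemH L (2 * l + 1) u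
  eqn : ∀ᵐ x ∂volume.restrict (Set.Ioo (0 : ℝ) L),
    a * u x + ∑ j ∈ Finset.Icc 1 l, (-1) ^ (j + 1) * weakDeriv L (2 * j + 1) u x
      + u x ^ k * weakDeriv L 1 u x = f x
  left : ∀ i < l, HasValueAt L (weakDeriv L i u) 0 0
  right : ∀ i < l, HasValueAt L (weakDeriv L i u) L 0
  right_top : HasValueAt L (weakDeriv L l u) L 0

/-- `((1+x), f²) = ∫₀ᴸ (1+x) f(x)² dx`. -/
noncomputable def weightedSq (L : ℝ) (f : L2 L) : ℝ :=
  ∫ x in Set.Ioo 0 L, (1 + x) * f x ^ 2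

/-!
Every regular solution is represented by a chain `U 0, U 1, …, U (2l+1)` of classical derivatives,
all but the last absolutely continuous on `[0,L]` (`IsAdmissible`); the passage between weak and
classical derivatives is the lemma of du Bois-Reymond (`IsRegularSolution.exists_isAdmissible`,
`IsAdmissible.isRegularSolution`). On such chains every estimate is an integration by parts.

Testing the equation with `ρ u`, `ρ = α + β x`, gives the identity
`∫ ρ u f + β/(k+2) ∫ u^{k+2} = a ∫ ρ u² + ∑_j (β (2j+1)/2 ‖Dʲu‖² + α/2 (Dʲu(0))²)`
(`IsAdmissible.nonlinear_energy_identity`). With `ρ = 1` it bounds `‖u‖` by `‖f‖/a` without any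
smallness. With `ρ = 1 + x` the remaining term `∫ u^{k+2}` has to be absorbed: the norms `‖Dʲu‖` are
log-convex in `j ≤ l`, hence `sup |u|^{4l} ≤ 4ˡ ‖u‖^{4l-2} ‖Dˡu‖²`, and for `k ≤ 4l` the factor in
front of `‖Dˡu‖²` is small once `f` is. So *every* solution with small right-hand side is uniformly
small (`IsAdmissible.sq_le_of_small`), and the weighted identity for the difference of two uniformly
small solutions gives Lipschitz dependence on `f` (`IsAdmissible.energy_sub_le`) and with it
uniqueness.

For existence, the linear problem is a first order system `Y' = M Y + g e` with `2l+1` two-point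
boundary conditions. The solution space of the homogeneous system has dimension `2l+1` and the
energy identity shows that the boundary map is injective on it, hence bijective. Duhamel's formula
then yields a linear solution operator `S` with `sup |Dⁱ(S g)| ≤ C ‖g‖` for `i ≤ 2l`
(`exists_linear_solution`). Finally `u = S g` solves the nonlinear problem if
`g + (S g)^k D(S g) = f`, and this equation in `L²(0,L)` is solved by contraction on a small ball
(`exists_regularSolution`).
-/

/-! ### Absolutely continuous primitives -/

/-- `F` is absolutely continuous on `[0,L]` with derivative `f` almost everywhere, i.e. `F` is a
primitive of the integrable function `f`. -/
structure IsPrim (L : ℝ) (F f : ℝ → ℝ) : Prop where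
  ac : AbsolutelyContinuousOnInterval F 0 L
  deriv : ∀ᵐ x ∂volume.restrict (Set.Ioo (0 : ℝ) L), HasDerivAt F (f x) x

namespace IsPrim

variable {L : ℝ} {F G f g : ℝ → ℝ}

theorem add (hF : IsPrim L F f) (hG : IsPrim L G g) :
    IsPrim L (fun x => F x + G x) (fun x => f x + g x) where
  ac := hF.ac.fun_add hG.ac
  deriv := by filter_upwards [hF.deriv, hG.deriv] with x h1 h2 using h1.add h2

theorem sub (hF : IsPrim L F f) (hG : IsPrim L G g) :
    IsPrim L (fun x => F x - G x) (fun x => f x - g x) where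
  ac := hF.ac.fun_sub hG.ac
  deriv := by filter_upwards [hF.deriv, hG.deriv] with x h1 h2 using h1.sub h2

theorem mul (hF : IsPrim L F f) (hG : IsPrim L G g) :
    IsPrim L (fun x => F x * G x) (fun x => f x * G x + F x * g x) where
  ac := hF.ac.fun_mul hG.ac
  deriv := by filter_upwards [hF.deriv, hG.deriv] with x h1 h2 using h1.mul h2

theorem const_mul (c : ℝ) (hF : IsPrim L F f) :
    IsPrim L (fun x => c * F x) (fun x => c * f x) where
  ac := hF.ac.const_mul c
  deriv := by filter_upwards [hF.deriv] with x h1 using h1.const_mul c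

theorem congr_ae (hF : IsPrim L F f)
    (h : ∀ᵐ x ∂volume.restrict (Set.Ioo (0 : ℝ) L), f x = g x) : IsPrim L F g where
  ac := hF.ac
  deriv := by filter_upwards [hF.deriv, h] with x h1 h2 using h2 ▸ h1

theorem of_hasDerivAt (h : ∀ x, HasDerivAt F (f x) x) (hf : Continuous f) : IsPrim L F f where
  ac := by
    refine ContDiffOn.absolutelyContinuousOnInterval (ContDiff.contDiffOn ?_)
    rw [contDiff_one_iff_deriv]
    refine ⟨fun x => (h x).differentiableAt, ?_⟩
    rwa [show _root_.deriv F = f from funext fun x => (h x).deriv]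
  deriv := Filter.Eventually.of_forall h

theorem const (c : ℝ) : IsPrim L (fun _ => c) (fun _ => 0) :=
  of_hasDerivAt (fun x => hasDerivAt_const x c) continuous_const

theorem pow (hF : IsPrim L F f) (n : ℕ) :
    IsPrim L (fun x => F x ^ (n + 1)) (fun x => (n + 1) * (F x ^ n * f x)) := by
  refine ⟨?_, ?_⟩
  · induction n with
    | zero => simpa using hF.ac
    | succ n ih => simpa only [pow_succ] using ih.fun_mul hF.ac
  · filter_upwards [hF.deriv] with x h
    simpa [mul_assoc] using h.fun_pow (n + 1)

theorem ae_restrict_Ioc (hL : 0 ≤ L) {p : ℝ → Prop}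
    (h : ∀ᵐ x ∂volume.restrict (Set.Ioo (0 : ℝ) L), p x) :
    ∀ᵐ x ∂volume.restrict (Set.uIoc 0 L), p x := by
  rw [Set.uIoc_of_le hL, ← restrict_Ioo_eq_restrict_Ioc]
  exact h

theorem of_integral (hL : 0 ≤ L) (hf : IntervalIntegrable f volume 0 L) :
    IsPrim L (fun x => ∫ t in 0..x, f t) f where
  ac := hf.absolutelyContinuousOnInterval_intervalIntegral Set.left_mem_uIcc
  deriv := by
    rw [ae_restrict_iff' measurableSet_Ioo]
    filter_upwards [hf.ae_hasDerivAt_integral] with x hx hx'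
    refine hx ?_ 0 Set.left_mem_uIcc
    rw [Set.uIcc_of_le hL]
    exact Set.Ioo_subset_Icc_self hx'

theorem continuousOn_uIcc (hF : IsPrim L F f) : ContinuousOn F (Set.uIcc 0 L) := hF.ac.continuousOn

theorem continuousOn (hL : 0 ≤ L) (hF : IsPrim L F f) : ContinuousOn F (Set.Icc 0 L) := by
  have := hF.ac.continuousOn
  rwa [Set.uIcc_of_le hL] at this

theorem intervalIntegrable (hL : 0 ≤ L) (hF : IsPrim L F f) :
    IntervalIntegrable f volume 0 L := by
  refine hF.ac.intervalIntegrable_deriv.congr_ae ?_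
  filter_upwards [ae_restrict_Ioc hL hF.deriv] with x hx using hx.deriv

theorem integral_eq_of_mem (hL : 0 ≤ L) (hF : IsPrim L F f) {x : ℝ} (hx : x ∈ Set.Icc 0 L) :
    ∫ t in 0..x, f t = F x - F 0 := by
  have hsub : Set.uIcc 0 x ⊆ Set.uIcc 0 L := by
    rw [Set.uIcc_of_le hL, Set.uIcc_of_le hx.1]
    exact Set.Icc_subset_Icc_right hx.2
  rw [← (hF.ac.mono hsub).integral_deriv_eq_sub]
  refine intervalIntegral.integral_congr_ae ?_
  have h := (ae_restrict_iff' measurableSet_uIoc).1 (ae_restrict_Ioc hL hF.deriv)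
  filter_upwards [h] with t ht ht'
  refine (ht ?_).deriv.symm
  rw [Set.uIoc_of_le hL]
  rw [Set.uIoc_of_le hx.1] at ht'
  exact ⟨ht'.1, ht'.2.trans hx.2⟩

theorem integral_eq (hL : 0 ≤ L) (hF : IsPrim L F f) : ∫ t in 0..L, f t = F L - F 0 :=
  hF.integral_eq_of_mem hL ⟨hL, le_rfl⟩

theorem exists_bound (hL : 0 ≤ L) (hF : IsPrim L F f) : ∃ C, ∀ x ∈ Set.Icc 0 L, |F x| ≤ C := by
  obtain ⟨C, hC⟩ := hF.ac.exists_bound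
  rw [Set.uIcc_of_le hL] at hC
  exact ⟨C, hC⟩

end IsPrim

theorem intervalIntegral_eq_setIntegral_Ioo {L : ℝ} (hL : 0 ≤ L) (f : ℝ → ℝ) :
    ∫ x in 0..L, f x = ∫ x in Set.Ioo 0 L, f x := by
  rw [intervalIntegral.integral_of_le hL, integral_Ioc_eq_integral_Ioo]

theorem intervalIntegrable_iff_Ioo {L : ℝ} (hL : 0 ≤ L) (f : ℝ → ℝ) :
    IntervalIntegrable f volume 0 L ↔ IntegrableOn f (Set.Ioo 0 L) :=
  intervalIntegrable_iff_integrableOn_Ioo_of_le hL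

theorem integral_mono_of_ae {L : ℝ} (hL : 0 ≤ L) {f g : ℝ → ℝ}
    (hf : IntervalIntegrable f volume 0 L) (hg : IntervalIntegrable g volume 0 L)
    (h : ∀ᵐ x ∂volume.restrict (Set.Ioo (0 : ℝ) L), f x ≤ g x) :
    ∫ x in 0..L, f x ≤ ∫ x in 0..L, g x := by
  rw [intervalIntegral_eq_setIntegral_Ioo hL, intervalIntegral_eq_setIntegral_Ioo hL]
  rw [intervalIntegrable_iff_Ioo hL] at hf hg
  exact integral_mono_ae hf hg h

theorem integral_congr_of_ae {L : ℝ} (hL : 0 ≤ L) {f g : ℝ → ℝ}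
    (h : ∀ᵐ x ∂volume.restrict (Set.Ioo (0 : ℝ) L), f x = g x) :
    ∫ x in 0..L, f x = ∫ x in 0..L, g x := by
  rw [intervalIntegral_eq_setIntegral_Ioo hL, intervalIntegral_eq_setIntegral_Ioo hL]
  exact integral_congr_ae h

/-- The Cauchy–Schwarz inequality on `(0,x)`. -/
theorem sq_intervalIntegral_mul_le {f g : ℝ → ℝ} {x : ℝ} (hx : 0 ≤ x)
    (hff : IntervalIntegrable (fun t => f t ^ 2) volume 0 x)
    (hfg : IntervalIntegrable (fun t => f t * g t) volume 0 x)
    (hgg : IntervalIntegrable (fun t => g t ^ 2) volume 0 x) :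
    (∫ t in 0..x, f t * g t) ^ 2 ≤ (∫ t in 0..x, f t ^ 2) * ∫ t in 0..x, g t ^ 2 := by
  -- The quadratic polynomial `s ↦ ∫ (s f + g)²` is nonnegative.
  have key : ∀ s : ℝ, 0 ≤ (∫ t in 0..x, f t ^ 2) * (s * s) +
      (2 * ∫ t in 0..x, f t * g t) * s + ∫ t in 0..x, g t ^ 2 := by
    intro s
    have h : 0 ≤ ∫ t in 0..x, (s * f t + g t) ^ 2 :=
      intervalIntegral.integral_nonneg hx fun t _ => sq_nonneg _
    have e : (fun t => (s * f t + g t) ^ 2) =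
        fun t => (s * s) * f t ^ 2 + (2 * s) * (f t * g t) + g t ^ 2 := by
      funext t; ring
    rw [e, intervalIntegral.integral_add ((hff.const_mul _).add (hfg.const_mul _)) hgg,
      intervalIntegral.integral_add (hff.const_mul _) (hfg.const_mul _),
      intervalIntegral.integral_const_mul, intervalIntegral.integral_const_mul] at h
    linarith
  have := discrim_le_zero key
  rw [discrim] at this
  nlinarith

theorem intervalIntegrable_finsetSum {ι : Type*} {L : ℝ} (s : Finset ι) {f : ι → ℝ → ℝ}
    (h : ∀ i ∈ s, IntervalIntegrable (f i) volume 0 L) :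
    IntervalIntegrable (fun x => ∑ i ∈ s, f i x) volume 0 L := by
  rw [← Finset.sum_fn]
  exact IntervalIntegrable.sum s h

/-! ### The energy identity -/

/-- `U` lists the successive derivatives `u, Du, …, D^{2l+1}u` of a function on `[0,L]` which
satisfies the boundary conditions of the problem; all but the last are absolutely continuous. -/
structure IsAdmissible (L : ℝ) (l : ℕ) (U : ℕ → ℝ → ℝ) : Prop where
  prim : ∀ i ≤ 2 * l, IsPrim L (U i) (U (i + 1))
  left : ∀ i < l, U i 0 = 0
  right : ∀ i ≤ l, U i L = 0

/-- The dispersive part `∑_{j=1}^l (-1)^{j+1} D^{2j+1}u`, with `U i` in place of `Dⁱu`. -/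
noncomputable def dispersion (l : ℕ) (U : ℕ → ℝ → ℝ) (x : ℝ) : ℝ :=
  ∑ j ∈ Finset.Icc 1 l, (-1) ^ (j + 1) * U (2 * j + 1) x

theorem dispersion_sub (l : ℕ) (U V : ℕ → ℝ → ℝ) (x : ℝ) :
    dispersion l (fun i x => U i x - V i x) x = dispersion l U x - dispersion l V x := by
  simp only [dispersion, mul_sub, Finset.sum_sub_distrib]

/-- The squared `L²`-norm of `Dʲu`. -/
noncomputable def energy (L : ℝ) (U : ℕ → ℝ → ℝ) (j : ℕ) : ℝ := ∫ x in 0..L, U j x ^ 2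

theorem energy_nonneg {L : ℝ} (hL : 0 ≤ L) (U : ℕ → ℝ → ℝ) (j : ℕ) : 0 ≤ energy L U j :=
  intervalIntegral.integral_nonneg hL fun _ _ => sq_nonneg _

namespace IsAdmissible

variable {L : ℝ} {l : ℕ} {U V : ℕ → ℝ → ℝ}

theorem sub (hU : IsAdmissible L l U) (hV : IsAdmissible L l V) :
    IsAdmissible L l (fun i x => U i x - V i x) where
  prim i hi := (hU.prim i hi).sub (hV.prim i hi)
  left i hi := by simp [hU.left i hi, hV.left i hi]
  right i hi := by simp [hU.right i hi, hV.right i hi]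

theorem continuousOn (hU : IsAdmissible L l U) {i : ℕ} (hi : i ≤ 2 * l) :
    ContinuousOn (U i) (Set.uIcc 0 L) := (hU.prim i hi).continuousOn_uIcc

theorem intervalIntegrable (hL : 0 ≤ L) (hU : IsAdmissible L l U) {i : ℕ} (hi : i ≤ 2 * l + 1) :
    IntervalIntegrable (U i) volume 0 L := by
  rcases i with _ | i
  · exact (hU.continuousOn (by omega)).intervalIntegrable
  · exact (hU.prim i (by omega)).intervalIntegrable hL

theorem intervalIntegrable_sq (hU : IsAdmissible L l U) {i : ℕ} (hi : i ≤ 2 * l) :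
    IntervalIntegrable (fun x => U i x ^ 2) volume 0 L :=
  ((hU.continuousOn hi).pow 2).intervalIntegrable

theorem isPrim_weight (α β : ℝ) : IsPrim L (fun x => α + β * x) (fun _ => β) := by
  refine IsPrim.of_hasDerivAt (fun x => ?_) continuous_const
  simpa using ((hasDerivAt_id x).const_mul β).const_add α

/-- For an affine weight `ρ`, the derivatives of `ρ u` are `Dᵖ(ρ u) = ρ Dᵖu + p ρ' D^{p-1}u`. -/
theorem isPrim_weight_mul (hU : IsAdmissible L l U) (α β : ℝ) {p : ℕ} (hp : p ≤ 2 * l) :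
    IsPrim L (fun x => (α + β * x) * U p x + p * β * U (p - 1) x)
      (fun x => (α + β * x) * U (p + 1) x + (p + 1 : ℕ) * β * U p x) := by
  have h1 := (isPrim_weight (L := L) α β).mul (hU.prim p hp)
  rcases p with _ | p
  · simpa [add_comm] using h1
  · refine (h1.add ((hU.prim p (by omega)).const_mul (((p + 1 : ℕ) : ℝ) * β))).congr_ae ?_
    refine Filter.Eventually.of_forall fun x => ?_
    push_cast
    ring

/-- Integration by parts `p ≤ l` times produces no boundary terms, as `Dⁱu` vanishes at both ends
for `i < l`. -/
theorem integral_weight_mul_eq (hL : 0 ≤ L) (hU : IsAdmissible L l U) (α β : ℝ) {n p : ℕ}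
    (hn : n ≤ 2 * l) (hp : p ≤ l) (hpn : p ≤ n) :
    ∫ x in 0..L, (α + β * x) * U 0 x * U (n + 1) x =
      (-1) ^ p * ∫ x in 0..L, ((α + β * x) * U p x + p * β * U (p - 1) x) * U (n + 1 - p) x := by
  induction p with
  | zero => simp
  | succ p ih =>
    rw [ih (by omega) (by omega)]
    obtain ⟨q, rfl⟩ : ∃ q, n = p + 1 + q := ⟨n - (p + 1), by omega⟩
    rw [show p + 1 + q + 1 - p = q + 1 + 1 by omega, show p + 1 + q + 1 - (p + 1) = q + 1 by omega]
    have hQ := hU.isPrim_weight_mul α β (p := p) (by omega)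
    have hR := hU.prim (q + 1) (by omega)
    have h := (hQ.mul hR).integral_eq hL
    have i1 := (hQ.intervalIntegrable hL).mul_continuousOn hR.continuousOn_uIcc
    have i2 := (hR.intervalIntegrable hL).continuousOn_mul hQ.continuousOn_uIcc
    rw [intervalIntegral.integral_add i1 i2, hU.left p (by omega), hU.right p (by omega),
      hU.left (p - 1) (by omega), hU.right (p - 1) (by omega)] at h
    simp only [mul_zero, add_zero, zero_mul, sub_zero] at h
    simp only [Nat.add_sub_cancel]
    rw [pow_succ]
    linear_combination (-1) ^ p * h

theorem integral_weight_mul_odd (hL : 0 ≤ L) (hU : IsAdmissible L l U) (α β : ℝ) {j : ℕ}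
    (hj : 1 ≤ j) (hjl : j ≤ l) :
    ∫ x in 0..L, (α + β * x) * U 0 x * ((-1) ^ (j + 1) * U (2 * j + 1) x) =
      β * ((2 * j + 1) / 2) * energy L U j + α / 2 * U j 0 ^ 2 := by
  have h1 := hU.integral_weight_mul_eq hL α β (n := 2 * j) (p := j) (by omega) hjl (by omega)
  rw [show 2 * j + 1 - j = j + 1 by omega] at h1
  have hj0 := hU.prim j (by omega)
  have hj1 := hU.prim (j - 1) (by omega)
  rw [Nat.sub_add_cancel hj] at hj1
  -- a primitive of `Dʲ(ρ u) D^{j+1}u + (2j+1)/2 ρ' (Dʲu)²`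
  have h2 := (((isPrim_weight (L := L) α β).mul (hj0.mul hj0)).const_mul (1 / 2)).add
    ((hj1.mul hj0).const_mul (j * β))
  have h3 : IsPrim L _ (fun x => ((α + β * x) * U j x + j * β * U (j - 1) x) * U (j + 1) x
      + β * ((2 * j + 1) / 2) * U j x ^ 2) :=
    h2.congr_ae (Filter.Eventually.of_forall fun x => by ring)
  have h4 := h3.integral_eq hL
  have i1 : IntervalIntegrable (fun x => ((α + β * x) * U j x + j * β * U (j - 1) x) * U (j + 1) x)
      volume 0 L :=
    (hU.intervalIntegrable hL (by omega)).continuousOn_mul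
      (hU.isPrim_weight_mul α β (by omega)).continuousOn_uIcc
  rw [intervalIntegral.integral_add i1 ((hU.intervalIntegrable_sq (by omega)).const_mul _),
    intervalIntegral.integral_const_mul, hU.right j hjl, hU.left (j - 1) (by omega),
    ← energy] at h4
  have h5 : ∫ x in 0..L, (α + β * x) * U 0 x * ((-1) ^ (j + 1) * U (2 * j + 1) x) =
      (-1) ^ (j + 1) * ∫ x in 0..L, (α + β * x) * U 0 x * U (2 * j + 1) x := by
    rw [← intervalIntegral.integral_const_mul]
    congr 1
    funext x
    ring
  rw [h5, h1, ← mul_assoc, ← pow_add, show j + 1 + j = 2 * j + 1 by ring, pow_succ, pow_mul]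
  simp only [neg_one_sq, one_pow, one_mul]
  linarith

/-- The energy identity: `a u + ∑ (-1)^{j+1} D^{2j+1}u = g` is multiplied by `ρ u`, `ρ = α + β x`,
and integrated over `(0,L)`. -/
theorem energy_identity (hL : 0 ≤ L) (hU : IsAdmissible L l U) {a : ℝ} {g : ℝ → ℝ}
    (hg : ∀ᵐ x ∂volume.restrict (Set.Ioo (0 : ℝ) L), a * U 0 x + dispersion l U x = g x)
    (α β : ℝ) :
    ∫ x in 0..L, (α + β * x) * U 0 x * g x =
      a * (∫ x in 0..L, (α + β * x) * U 0 x ^ 2) +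
        ∑ j ∈ Finset.Icc 1 l, (β * ((2 * j + 1) / 2) * energy L U j + α / 2 * U j 0 ^ 2) := by
  have hc : ContinuousOn (fun x => (α + β * x) * U 0 x) (Set.uIcc 0 L) :=
    (by fun_prop : Continuous fun x : ℝ => α + β * x).continuousOn.mul
      (hU.continuousOn (by omega))
  have hi : ∀ j ∈ Finset.Icc 1 l, IntervalIntegrable
      (fun x => (α + β * x) * U 0 x * ((-1) ^ (j + 1) * U (2 * j + 1) x)) volume 0 L := by
    intro j hj
    have := (Finset.mem_Icc.1 hj).2
    exact ((hU.intervalIntegrable hL (by omega)).const_mul _).continuousOn_mul hc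
  have h1 : ∫ x in 0..L, (α + β * x) * U 0 x * g x =
      ∫ x in 0..L, (a * ((α + β * x) * U 0 x ^ 2) +
        ∑ j ∈ Finset.Icc 1 l, (α + β * x) * U 0 x * ((-1) ^ (j + 1) * U (2 * j + 1) x)) := by
    refine integral_congr_of_ae hL ?_
    filter_upwards [hg] with x hx
    rw [← hx, dispersion, mul_add, Finset.mul_sum]
    ring
  rw [h1, intervalIntegral.integral_add, intervalIntegral.integral_const_mul,
    intervalIntegral.integral_finsetSum hi]
  · congr 1
    refine Finset.sum_congr rfl fun j hj => ?_
    exact hU.integral_weight_mul_odd hL α β (Finset.mem_Icc.1 hj).1 (Finset.mem_Icc.1 hj).2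
  · refine (ContinuousOn.intervalIntegrable ?_).const_mul a
    exact (by fun_prop : Continuous fun x : ℝ => α + β * x).continuousOn.mul
      ((hU.continuousOn (by omega)).pow 2)
  · exact intervalIntegrable_finsetSum _ hi

end IsAdmissible

/-! ### A priori estimates for the nonlinear problem -/

section SquareIntegrable

variable {L : ℝ} {f g : ℝ → ℝ}

theorem MeasureTheory.MemLp.intervalIntegrable_Ioo (hL : 0 ≤ L)
    (hf : MemLp f 2 (volume.restrict (Set.Ioo (0 : ℝ) L))) : IntervalIntegrable f volume 0 L :=
  (intervalIntegrable_iff_Ioo hL f).2 (hf.integrable (by norm_num))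

theorem MeasureTheory.MemLp.intervalIntegrable_sq_Ioo (hL : 0 ≤ L)
    (hf : MemLp f 2 (volume.restrict (Set.Ioo (0 : ℝ) L))) :
    IntervalIntegrable (fun x => f x ^ 2) volume 0 L :=
  (intervalIntegrable_iff_Ioo hL _).2 hf.integrable_sq

end SquareIntegrable

/-- A log-convex sequence of nonnegative numbers satisfies `c₁ⁿ ≤ c₀ⁿ⁻¹ cₙ`. -/
theorem pow_le_mul_of_logConvex {c : ℕ → ℝ} {l : ℕ} (h0 : ∀ j, 0 ≤ c j)
    (h : ∀ j < l, c (j + 1) ^ 2 ≤ c j * c (j + 2)) {n : ℕ} (hn : n ≤ l) :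
    c 1 ^ (n + 1) ≤ c 0 ^ n * c (n + 1) := by
  have hratio : ∀ n ≤ l, c 1 * c n ≤ c 0 * c (n + 1) := by
    intro n
    induction n with
    | zero => intro _; rw [mul_comm]
    | succ n ih =>
      intro hn
      rcases (h0 (n + 1)).eq_or_lt with hz | hpos
      · rw [← hz, mul_zero]
        exact mul_nonneg (h0 _) (h0 _)
      · refine le_of_mul_le_mul_right ?_ hpos
        calc c 1 * c (n + 1) * c (n + 1) = c 1 * c (n + 1) ^ 2 := by ring
          _ ≤ c 1 * (c n * c (n + 2)) := mul_le_mul_of_nonneg_left (h n (by omega)) (h0 _)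
          _ = c 1 * c n * c (n + 2) := by ring
          _ ≤ c 0 * c (n + 1) * c (n + 2) := mul_le_mul_of_nonneg_right (ih (by omega)) (h0 _)
          _ = c 0 * c (n + 1 + 1) * c (n + 1) := by ring
  induction n with
  | zero => simp
  | succ n ih =>
    calc c 1 ^ (n + 1 + 1) = c 1 ^ (n + 1) * c 1 := pow_succ _ _
      _ ≤ c 0 ^ n * c (n + 1) * c 1 := mul_le_mul_of_nonneg_right (ih (by omega)) (h0 _)
      _ = c 0 ^ n * (c 1 * c (n + 1)) := by ring
      _ ≤ c 0 ^ n * (c 0 * c (n + 1 + 1)) :=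
        mul_le_mul_of_nonneg_left (hratio (n + 1) hn) (pow_nonneg (h0 0) n)
      _ = c 0 ^ (n + 1) * c (n + 1 + 1) := by ring

namespace IsAdmissible

variable {L : ℝ} {l : ℕ} {U V : ℕ → ℝ → ℝ}

theorem energy_logConvex (hL : 0 ≤ L) (hU : IsAdmissible L l U) {j : ℕ} (hj : j < l) :
    energy L U (j + 1) ^ 2 ≤ energy L U j * energy L U (j + 2) := by
  have c0 := hU.continuousOn (i := j) (by omega)
  have c1 := hU.continuousOn (i := j + 1) (by omega)
  have c2 := hU.continuousOn (i := j + 2) (by omega)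
  have h := ((hU.prim j (by omega)).mul (hU.prim (j + 1) (by omega))).integral_eq hL
  rw [intervalIntegral.integral_add (c1.fun_mul c1).intervalIntegrable
    (c0.fun_mul c2).intervalIntegrable,
    hU.left j hj, hU.right j (by omega)] at h
  have h2 : energy L U (j + 1) = -∫ x in 0..L, U j x * U (j + 2) x := by
    simp only [energy, sq]
    linarith
  rw [h2, neg_sq]
  exact sq_intervalIntegral_mul_le hL (hU.intervalIntegrable_sq (by omega))
    (c0.mul c2).intervalIntegrable (hU.intervalIntegrable_sq (by omega))

theorem sq_sq_le (hL : 0 ≤ L) (hl : 1 ≤ l) (hU : IsAdmissible L l U) {x : ℝ}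
    (hx : x ∈ Set.Icc 0 L) : (U 0 x ^ 2) ^ 2 ≤ 4 * (energy L U 0 * energy L U 1) := by
  have hsub : Set.uIcc 0 x ⊆ Set.uIcc 0 L := by
    rw [Set.uIcc_of_le hL, Set.uIcc_of_le hx.1]
    exact Set.Icc_subset_Icc_right hx.2
  have c0 := (hU.continuousOn (i := 0) (by omega)).mono hsub
  have c1 := (hU.continuousOn (i := 1) (by omega)).mono hsub
  have h := (((hU.prim 0 (by omega)).mul (hU.prim 0 (by omega))).congr_ae (g := fun x =>
    2 * (U 0 x * U 1 x)) (Filter.Eventually.of_forall fun x => by ring)).integral_eq_of_mem hL hx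
  rw [intervalIntegral.integral_const_mul, hU.left 0 (by omega)] at h
  have hcs := sq_intervalIntegral_mul_le hx.1 (c0.pow 2).intervalIntegrable
    (c0.mul c1).intervalIntegrable (c1.pow 2).intervalIntegrable
  have hmono : ∀ i ≤ 2 * l, ∫ t in 0..x, U i t ^ 2 ≤ energy L U i := fun i hi =>
    intervalIntegral.integral_mono_interval le_rfl hx.1 hx.2
      (Filter.Eventually.of_forall fun t => sq_nonneg _) (hU.intervalIntegrable_sq hi)
  have hm := mul_le_mul (hmono 0 (by omega)) (hmono 1 (by omega))
    (intervalIntegral.integral_nonneg hx.1 fun _ _ => sq_nonneg _) (energy_nonneg hL U 0)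
  have h3 : U 0 x ^ 2 = 2 * ∫ t in 0..x, U 0 t * U 1 t := by linarith [h]
  rw [h3]
  nlinarith

/-- The nonlinearity `uᵏ Du`, tested with `ρ u` for an affine weight `ρ`, leaves only a term with
`ρ'`. -/
theorem integral_weight_nonlinear (hL : 0 ≤ L) (hl : 1 ≤ l) (hU : IsAdmissible L l U) (k : ℕ)
    (α β : ℝ) :
    ∫ x in 0..L, (α + β * x) * U 0 x * (U 0 x ^ k * U 1 x) =
      -(β / (k + 2)) * ∫ x in 0..L, U 0 x ^ (k + 2) := by
  have hk : (k : ℝ) + 2 ≠ 0 := by positivity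
  have c0 := hU.continuousOn (i := 0) (by omega)
  have c1 := hU.continuousOn (i := 1) (by omega)
  have hw : ContinuousOn (fun x : ℝ => α + β * x) (Set.uIcc 0 L) := by fun_prop
  have h := ((isPrim_weight (L := L) α β).mul
    (((hU.prim 0 (by omega)).pow (k + 1)).const_mul (1 / (k + 2)))).congr_ae
    (g := fun x => β / (k + 2) * U 0 x ^ (k + 2) + (α + β * x) * U 0 x * (U 0 x ^ k * U 1 x))
    (Filter.Eventually.of_forall fun x => by push_cast; field_simp; ring)
  have h2 := h.integral_eq hL
  rw [intervalIntegral.integral_add ((c0.fun_pow _).intervalIntegrable.const_mul _)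
    ((hw.fun_mul c0).fun_mul ((c0.fun_pow k).fun_mul c1)).intervalIntegrable,
    intervalIntegral.integral_const_mul, hU.left 0 (by omega), hU.right 0 (by omega)] at h2
  simp only [ne_eq, Nat.add_eq_zero_iff, one_ne_zero, and_false, not_false_eq_true, zero_pow,
    mul_zero, sub_zero] at h2
  linarith

section Nonlinear

variable {a : ℝ} {k : ℕ} {f f₁ f₂ : ℝ → ℝ}

/-- The energy identity for a solution of the nonlinear problem. -/
theorem nonlinear_energy_identity (hL : 0 ≤ L) (hl : 1 ≤ l) (hU : IsAdmissible L l U)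
    (hf : MemLp f 2 (volume.restrict (Set.Ioo (0 : ℝ) L)))
    (h : ∀ᵐ x ∂volume.restrict (Set.Ioo (0 : ℝ) L),
      a * U 0 x + dispersion l U x + U 0 x ^ k * U 1 x = f x) (α β : ℝ) :
    (∫ x in 0..L, (α + β * x) * U 0 x * f x) + β / (k + 2) * (∫ x in 0..L, U 0 x ^ (k + 2)) =
      a * (∫ x in 0..L, (α + β * x) * U 0 x ^ 2) +
        ∑ j ∈ Finset.Icc 1 l, (β * ((2 * j + 1) / 2) * energy L U j + α / 2 * U j 0 ^ 2) := by
  have c0 := hU.continuousOn (i := 0) (by omega)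
  have c1 := hU.continuousOn (i := 1) (by omega)
  have hw : ContinuousOn (fun x : ℝ => α + β * x) (Set.uIcc 0 L) := by fun_prop
  have h1 := hU.energy_identity hL (a := a) (g := fun x => f x - U 0 x ^ k * U 1 x)
    (by filter_upwards [h] with x hx; linarith) α β
  rw [← h1]
  simp only [mul_sub]
  rw [intervalIntegral.integral_sub
    ((hf.intervalIntegrable_Ioo hL).continuousOn_mul (hw.fun_mul c0))
    ((hw.fun_mul c0).fun_mul ((c0.fun_pow k).fun_mul c1)).intervalIntegrable,
    hU.integral_weight_nonlinear hL hl]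
  ring

/-- The `L²`-estimate, which needs no smallness. -/
theorem sq_mul_energy_zero_le (ha : 0 < a) (hL : 0 ≤ L) (hl : 1 ≤ l) (hU : IsAdmissible L l U)
    (hf : MemLp f 2 (volume.restrict (Set.Ioo (0 : ℝ) L)))
    (h : ∀ᵐ x ∂volume.restrict (Set.Ioo (0 : ℝ) L),
      a * U 0 x + dispersion l U x + U 0 x ^ k * U 1 x = f x) :
    a ^ 2 * energy L U 0 ≤ ∫ x in 0..L, f x ^ 2 := by
  have c0 := hU.continuousOn (i := 0) (by omega)
  have h1 := hU.nonlinear_energy_identity hL hl hf h 1 0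
  simp only [zero_mul, add_zero, one_mul, zero_div, zero_add] at h1
  have h2 : 0 ≤ ∑ j ∈ Finset.Icc 1 l, (1 / 2 : ℝ) * U j 0 ^ 2 :=
    Finset.sum_nonneg fun j _ => by positivity
  have i1 := (hf.intervalIntegrable_sq_Ioo hL).const_mul (1 / (2 * a))
  have i2 := (hU.intervalIntegrable_sq (i := 0) (by omega)).const_mul (a / 2)
  have h3 : ∫ x in 0..L, U 0 x * f x ≤
      ∫ x in 0..L, (1 / (2 * a) * f x ^ 2 + a / 2 * U 0 x ^ 2) := by
    refine integral_mono_of_ae hL ((hf.intervalIntegrable_Ioo hL).continuousOn_mul c0)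
      (i1.add i2) (Filter.Eventually.of_forall fun x => ?_)
    have : 1 / (2 * a) * f x ^ 2 + a / 2 * U 0 x ^ 2 - U 0 x * f x =
        1 / (2 * a) * (f x - a * U 0 x) ^ 2 := by field_simp; ring
    have : 0 ≤ 1 / (2 * a) * (f x - a * U 0 x) ^ 2 := by positivity
    linarith
  rw [intervalIntegral.integral_add i1 i2, intervalIntegral.integral_const_mul,
    intervalIntegral.integral_const_mul] at h3
  have h4 : a / 2 * energy L U 0 ≤ 1 / (2 * a) * ∫ x in 0..L, f x ^ 2 := by
    simp only [energy] at *
    linarith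
  calc a ^ 2 * energy L U 0 = 2 * a * (a / 2 * energy L U 0) := by ring
    _ ≤ 2 * a * (1 / (2 * a) * ∫ x in 0..L, f x ^ 2) := by gcongr
    _ = _ := by field_simp

theorem sum_energy_ge (hL : 0 ≤ L) (U : ℕ → ℝ → ℝ) {j : ℕ}
    (hj : 1 ≤ j) (hjl : j ≤ l) :
    3 / 2 * energy L U j ≤
      ∑ j ∈ Finset.Icc 1 l, ((1 : ℝ) * ((2 * j + 1) / 2) * energy L U j + 1 / 2 * U j 0 ^ 2) := by
  have hnn : ∀ j ∈ Finset.Icc 1 l,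
      0 ≤ (1 : ℝ) * ((2 * j + 1) / 2) * energy L U j + 1 / 2 * U j 0 ^ 2 := by
    intro j _
    have := energy_nonneg hL U j
    positivity
  refine le_trans ?_ (Finset.single_le_sum hnn (Finset.mem_Icc.2 ⟨hj, hjl⟩))
  have h1 : (1 : ℝ) ≤ j := by exact_mod_cast hj
  have h2 := energy_nonneg hL U j
  nlinarith [sq_nonneg (U j 0)]

/-- This is where `k ≤ 4l` enters: by interpolation `sup |u|^{4l}` is bounded by
`‖u‖^{4l-2} ‖Dˡu‖²`, which is only quadratic in the highest norm. -/
theorem integral_pow_le (hL : 0 ≤ L) (hl : 1 ≤ l) (hkl : k ≤ 4 * l) (hU : IsAdmissible L l U) :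
    ∫ x in 0..L, U 0 x ^ (k + 2) ≤
      energy L U 0 + 4 ^ l * energy L U 0 ^ (2 * l) * energy L U l := by
  have c0 := hU.continuousOn (i := 0) (by omega)
  have hinterp : energy L U 1 ^ l ≤ energy L U 0 ^ (l - 1) * energy L U l := by
    have := pow_le_mul_of_logConvex (energy_nonneg hL U)
      (fun j hj => hU.energy_logConvex hL hj) (n := l - 1) (by omega)
    rwa [Nat.sub_add_cancel hl] at this
  set B := 4 ^ l * (energy L U 0 ^ l * (energy L U 0 ^ (l - 1) * energy L U l)) with hB
  have h0 := energy_nonneg hL U 0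
  have hpt : ∀ x ∈ Set.Icc 0 L, U 0 x ^ (k + 2) ≤ (1 + B) * U 0 x ^ 2 := by
    intro x hx
    have h1 : |U 0 x| ^ (4 * l) ≤ B := by
      calc |U 0 x| ^ (4 * l) = ((U 0 x ^ 2) ^ 2) ^ l := by
            rw [← sq_abs (U 0 x), ← pow_mul, ← pow_mul]
            congr 1
            ring
        _ ≤ (4 * (energy L U 0 * energy L U 1)) ^ l :=
            pow_le_pow_left₀ (by positivity) (hU.sq_sq_le hL hl hx) l
        _ = 4 ^ l * (energy L U 0 ^ l * energy L U 1 ^ l) := by rw [mul_pow, mul_pow]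
        _ ≤ B := by rw [hB]; gcongr
    have h2 : |U 0 x| ^ k ≤ 1 + |U 0 x| ^ (4 * l) := by
      rcases le_total |U 0 x| 1 with h | h
      · exact (pow_le_one₀ (abs_nonneg _) h).trans
          (le_add_of_nonneg_right (by positivity))
      · exact (pow_le_pow_right₀ h hkl).trans (by linarith)
    calc U 0 x ^ (k + 2) ≤ |U 0 x ^ (k + 2)| := le_abs_self _
      _ = |U 0 x| ^ k * U 0 x ^ 2 := by rw [abs_pow, pow_add, sq_abs]
      _ ≤ (1 + B) * U 0 x ^ 2 := by gcongr; linarith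
  have h3 := intervalIntegral.integral_mono_on hL (c0.pow (k + 2)).intervalIntegrable
    ((hU.intervalIntegrable_sq (i := 0) (by omega)).const_mul (1 + B)) hpt
  rw [intervalIntegral.integral_const_mul, ← energy] at h3
  refine h3.trans (le_of_eq ?_)
  rw [hB, show 2 * l = l + (l - 1) + 1 by omega, pow_succ, pow_add]
  ring

theorem weight_mem {x : ℝ} (hx : x ∈ Set.Ioo 0 L) : 1 ≤ 1 + 1 * x ∧ 1 + 1 * x ≤ 1 + L :=
  ⟨by linarith [hx.1], by linarith [hx.2]⟩

theorem energy_zero_le_weighted (hL : 0 ≤ L) (hU : IsAdmissible L l U) :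
    energy L U 0 ≤ ∫ x in 0..L, (1 + 1 * x) * U 0 x ^ 2 := by
  refine integral_mono_of_ae hL (hU.intervalIntegrable_sq (by omega)) ?_ ?_
  · exact ((by fun_prop : ContinuousOn (fun x : ℝ => 1 + 1 * x) (Set.uIcc 0 L)).mul
      ((hU.continuousOn (by omega)).pow 2)).intervalIntegrable
  · filter_upwards [ae_restrict_mem measurableSet_Ioo] with x hx
    nlinarith [(weight_mem hx).1, sq_nonneg (U 0 x)]

/-- Young's inequality for the right-hand side, tested with `(1+x) u`. -/
theorem integral_weight_mul_le (hL : 0 ≤ L) (hU : IsAdmissible L l U)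
    (hf : MemLp f 2 (volume.restrict (Set.Ioo (0 : ℝ) L))) {c : ℝ} (hc : 0 < c) :
    ∫ x in 0..L, (1 + 1 * x) * U 0 x * f x ≤
      (1 + L) / 2 * (c * (∫ x in 0..L, f x ^ 2) + c⁻¹ * energy L U 0) := by
  have c0 := hU.continuousOn (i := 0) (by omega)
  have i1 := (hf.intervalIntegrable_sq_Ioo hL).const_mul c
  have i2 := (hU.intervalIntegrable_sq (i := 0) (by omega)).const_mul c⁻¹
  have h := integral_mono_of_ae hL (f := fun x => (1 + 1 * x) * U 0 x * f x)
    (g := fun x => (1 + L) / 2 * (c * f x ^ 2 + c⁻¹ * U 0 x ^ 2))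
    ((hf.intervalIntegrable_Ioo hL).continuousOn_mul
      ((by fun_prop : ContinuousOn (fun x : ℝ => 1 + 1 * x) (Set.uIcc 0 L)).mul c0))
    ((i1.add i2).const_mul _) ?_
  · rwa [intervalIntegral.integral_const_mul, intervalIntegral.integral_add i1 i2,
      intervalIntegral.integral_const_mul, intervalIntegral.integral_const_mul] at h
  · filter_upwards [ae_restrict_mem measurableSet_Ioo] with x hx
    obtain ⟨h1, h2⟩ := weight_mem hx
    have h3 : 0 ≤ c * f x ^ 2 + c⁻¹ * U 0 x ^ 2 := by positivity
    have h4 : c * f x ^ 2 + c⁻¹ * U 0 x ^ 2 - 2 * (U 0 x * f x) = c⁻¹ * (c * f x - U 0 x) ^ 2 := by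
      field_simp; ring
    have h5 : 0 ≤ c⁻¹ * (c * f x - U 0 x) ^ 2 := by positivity
    calc (1 + 1 * x) * U 0 x * f x = (1 + 1 * x) * (U 0 x * f x) := by ring
      _ ≤ (1 + 1 * x) * ((c * f x ^ 2 + c⁻¹ * U 0 x ^ 2) / 2) :=
        mul_le_mul_of_nonneg_left (by linarith) (by linarith)
      _ ≤ (1 + L) * ((c * f x ^ 2 + c⁻¹ * U 0 x ^ 2) / 2) :=
        mul_le_mul_of_nonneg_right h2 (by linarith)
      _ = _ := by ring

/-- Every solution with small right-hand side is uniformly small. -/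
theorem sq_le_of_small (ha : 0 < a) (hL : 0 ≤ L) (hl : 1 ≤ l) (hkl : k ≤ 4 * l)
    (hU : IsAdmissible L l U) (hf : MemLp f 2 (volume.restrict (Set.Ioo (0 : ℝ) L)))
    (h : ∀ᵐ x ∂volume.restrict (Set.Ioo (0 : ℝ) L),
      a * U 0 x + dispersion l U x + U 0 x ^ k * U 1 x = f x)
    (hsmall : 4 * ∫ x in 0..L, f x ^ 2 ≤ a ^ 2) {x : ℝ} (hx : x ∈ Set.Icc 0 L) :
    U 0 x ^ 2 ≤ 2 * ((3 + L) * (1 + 1 / a ^ 2)) * ∫ x in 0..L, f x ^ 2 := by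
  set F := ∫ x in 0..L, f x ^ 2 with hF
  have hF0 : 0 ≤ F := intervalIntegral.integral_nonneg hL fun _ _ => sq_nonneg _
  have e0 := energy_nonneg hL U 0
  have e1 := energy_nonneg hL U 1
  have el := energy_nonneg hL U l
  have hE0 : energy L U 0 ≤ 1 / a ^ 2 * F := by
    have := hU.sq_mul_energy_zero_le ha hL hl hf h
    rw [one_div, inv_mul_eq_div, le_div_iff₀ (by positivity)]
    linarith
  have hE0' : energy L U 0 ≤ 1 / 4 := by
    refine hE0.trans ?_
    rw [one_div, inv_mul_eq_div, div_le_iff₀ (by positivity)]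
    linarith
  -- this coefficient lets the weighted identity absorb `∫ u^{k+2}`
  have hcoef : 4 ^ l * energy L U 0 ^ (2 * l) ≤ 1 / 2 := by
    calc (4 : ℝ) ^ l * energy L U 0 ^ (2 * l) = (4 * energy L U 0 ^ 2) ^ l := by
          rw [mul_pow, pow_mul]
      _ ≤ 4 * energy L U 0 ^ 2 := pow_le_of_le_one (by positivity) (by nlinarith) (by omega)
      _ ≤ 1 / 2 := by nlinarith
  have hp := hU.integral_pow_le (k := k) hL hl hkl
  have hp2 : (1 : ℝ) / (k + 2) * ∫ x in 0..L, U 0 x ^ (k + 2) ≤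
      energy L U 0 + 1 / 2 * energy L U l := by
    have hb : 0 ≤ energy L U 0 + 1 / 2 * energy L U l := by positivity
    have hk1 : (1 : ℝ) / (k + 2) ≤ 1 := by
      rw [div_le_one (by positivity)]
      linarith [(Nat.cast_nonneg k : (0 : ℝ) ≤ k)]
    calc (1 : ℝ) / (k + 2) * ∫ x in 0..L, U 0 x ^ (k + 2)
        ≤ 1 / (k + 2) * (energy L U 0 + 1 / 2 * energy L U l) := by
          refine mul_le_mul_of_nonneg_left (hp.trans ?_) (by positivity)
          have := mul_le_mul_of_nonneg_right hcoef el
          linarith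
      _ ≤ _ := mul_le_of_le_one_left hb hk1
  have hid := hU.nonlinear_energy_identity hL hl hf h 1 1
  have hw := hU.energy_zero_le_weighted hL
  have hy := hU.integral_weight_mul_le hL hf one_pos
  have hs1 := sum_energy_ge hL U (j := 1) le_rfl hl
  have hsl := sum_energy_ge hL U (j := l) hl le_rfl
  have haw : 0 ≤ a * ∫ x in 0..L, (1 + 1 * x) * U 0 x ^ 2 := mul_nonneg ha.le (e0.trans hw)
  have hE1 : energy L U 1 ≤ (3 + L) * ((1 + 1 / a ^ 2) * F) := by
    have h1 : energy L U 1 ≤ (1 + L) * (F + energy L U 0) + 2 * energy L U 0 := by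
      rw [inv_one] at hy
      linarith
    have h2 : F + energy L U 0 ≤ (1 + 1 / a ^ 2) * F := by linarith
    nlinarith
  have hq : (U 0 x ^ 2) ^ 2 ≤ (2 * ((3 + L) * (1 + 1 / a ^ 2)) * F) ^ 2 := by
    refine (hU.sq_sq_le hL hl hx).trans ?_
    have hE0'' : energy L U 0 ≤ (3 + L) * ((1 + 1 / a ^ 2) * F) := by
      have : 0 ≤ (1 + 1 / a ^ 2) * F := by positivity
      nlinarith
    have := mul_le_mul hE0'' hE1 e1 (e0.trans hE0'')
    calc 4 * (energy L U 0 * energy L U 1) ≤ _ := mul_le_mul_of_nonneg_left this (by norm_num)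
      _ = _ := by ring
  exact le_of_sq_le_sq hq (by positivity)

/-- Two uniformly small solutions depend Lipschitz continuously on the right-hand side. The
difference of the nonlinearities is the derivative of `(u^{k+1} - v^{k+1})/(k+1)`. -/
theorem energy_sub_le (ha : 0 < a) (hL : 0 ≤ L) (hl : 1 ≤ l)
    (hU : IsAdmissible L l U) (hV : IsAdmissible L l V)
    (hf₁ : MemLp f₁ 2 (volume.restrict (Set.Ioo (0 : ℝ) L)))
    (hf₂ : MemLp f₂ 2 (volume.restrict (Set.Ioo (0 : ℝ) L)))
    (h₁ : ∀ᵐ x ∂volume.restrict (Set.Ioo (0 : ℝ) L),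
      a * U 0 x + dispersion l U x + U 0 x ^ k * U 1 x = f₁ x)
    (h₂ : ∀ᵐ x ∂volume.restrict (Set.Ioo (0 : ℝ) L),
      a * V 0 x + dispersion l V x + V 0 x ^ k * V 1 x = f₂ x)
    {ε : ℝ} (hUε : ∀ x ∈ Set.Icc 0 L, |U 0 x| ≤ ε) (hVε : ∀ x ∈ Set.Icc 0 L, |V 0 x| ≤ ε)
    (hε1 : ε ^ k * (2 + L) ≤ 1) (hε2 : ε ^ k * (2 + L) ≤ a / 2) :
    energy L (fun i x => U i x - V i x) 0 ≤
      (2 * (1 + L) / a) ^ 2 * ∫ x in 0..L, (f₁ x - f₂ x) ^ 2 := by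
  have hε0 : 0 ≤ ε := (abs_nonneg _).trans (hUε 0 ⟨le_rfl, hL⟩)
  have hW := hU.sub hV
  set W : ℕ → ℝ → ℝ := fun i x => U i x - V i x with hWdef
  have u0 := hU.continuousOn (i := 0) (by omega)
  have u1 := hU.continuousOn (i := 1) (by omega)
  have v0 := hV.continuousOn (i := 0) (by omega)
  have v1 := hV.continuousOn (i := 1) (by omega)
  have w0 := hW.continuousOn (i := 0) (by omega)
  have w1 := hW.continuousOn (i := 1) (by omega)
  have hw : ContinuousOn (fun x : ℝ => 1 + 1 * x) (Set.uIcc 0 L) := by fun_prop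
  have hf := hf₁.sub hf₂
  set N : ℝ → ℝ := fun x => U 0 x ^ k * U 1 x - V 0 x ^ k * V 1 x with hN
  set P : ℝ → ℝ := fun x => 1 / (k + 1) * (U 0 x ^ (k + 1) - V 0 x ^ (k + 1)) with hP
  have hPN : IsPrim L P N := by
    refine ((((hU.prim 0 (by omega)).pow k).sub ((hV.prim 0 (by omega)).pow k)).const_mul
      (1 / ((k : ℝ) + 1))).congr_ae (Filter.Eventually.of_forall fun x => ?_)
    simp only [hN]
    field_simp
  have hPc := hPN.continuousOn_uIcc
  have hNc : ContinuousOn N (Set.uIcc 0 L) := ((u0.pow k).mul u1).sub ((v0.pow k).mul v1)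
  have hPb : ∀ x ∈ Set.Icc 0 L, |P x| ≤ ε ^ k * |W 0 x| := by
    intro x hx
    have h1 := abs_pow_sub_pow_le (U 0 x) (V 0 x) (k + 1)
    have h2 : max |U 0 x| |V 0 x| ^ k ≤ ε ^ k :=
      pow_le_pow_left₀ (le_max_of_le_left (abs_nonneg _)) (max_le (hUε x hx) (hVε x hx)) k
    have hk : (0 : ℝ) < k + 1 := by positivity
    simp only [Nat.add_sub_cancel] at h1
    push_cast at h1
    simp only [hP, hWdef]
    rw [abs_mul, abs_of_pos (by positivity : (0 : ℝ) < 1 / (k + 1)), one_div, inv_mul_eq_div,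
      div_le_iff₀ hk]
    refine h1.trans ?_
    have := mul_le_mul_of_nonneg_left h2
      (mul_nonneg (abs_nonneg (U 0 x - V 0 x)) hk.le)
    linarith
  -- the energy identity for the difference
  have hid := hW.energy_identity hL (a := a) (g := fun x => (f₁ - f₂) x - N x) (by
    filter_upwards [h₁, h₂] with x h1 h2
    simp only [Pi.sub_apply, hN, hWdef, dispersion_sub]
    linarith) 1 1
  simp only [mul_sub] at hid
  rw [intervalIntegral.integral_sub
    ((hf.intervalIntegrable_Ioo hL).continuousOn_mul (hw.fun_mul w0))
    ((hw.fun_mul w0).fun_mul hNc).intervalIntegrable] at hid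
  -- integration by parts in the nonlinear term
  have hbp := (((isPrim_weight (L := L) 1 1).mul (hW.prim 0 (by omega))).mul hPN).integral_eq hL
  rw [intervalIntegral.integral_add
    (((continuousOn_const.fun_mul w0).fun_add (hw.fun_mul w1)).fun_mul hPc).intervalIntegrable
    ((hw.fun_mul w0).fun_mul hNc).intervalIntegrable, hW.left 0 (by omega),
    hW.right 0 (by omega)] at hbp
  simp only [mul_zero, zero_mul, sub_zero] at hbp
  have j0 := hW.intervalIntegrable_sq (i := 0) (by omega)
  have j1 := hW.intervalIntegrable_sq (i := 1) (by omega)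
  have hNL := intervalIntegral.integral_mono_on hL
    (f := fun x => (1 * W 0 x + (1 + 1 * x) * W 1 x) * P x)
    (g := fun x => a / 2 * W 0 x ^ 2 + 1 / 2 * W 1 x ^ 2)
    (((continuousOn_const.mul w0).add (hw.mul w1)).mul hPc).intervalIntegrable
    ((j0.const_mul (a / 2)).add (j1.const_mul (1 / 2))) (by
      intro x hx
      have hp := hPb x hx
      have ht : 0 ≤ ε ^ k := pow_nonneg hε0 k
      have h1 : |1 * W 0 x + (1 + 1 * x) * W 1 x| ≤ |W 0 x| + (1 + L) * |W 1 x| := by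
        refine (abs_add_le _ _).trans ?_
        rw [one_mul, abs_mul, abs_of_nonneg (by linarith [hx.1] : 0 ≤ 1 + 1 * x)]
        gcongr
        linarith [hx.2]
      calc (1 * W 0 x + (1 + 1 * x) * W 1 x) * P x
          ≤ |1 * W 0 x + (1 + 1 * x) * W 1 x| * |P x| := by
            rw [← abs_mul]; exact le_abs_self _
        _ ≤ (|W 0 x| + (1 + L) * |W 1 x|) * (ε ^ k * |W 0 x|) := by gcongr
        _ ≤ ε ^ k * (2 + L) * W 0 x ^ 2 + ε ^ k * (2 + L) * (1 / 2 * W 1 x ^ 2) := by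
            rw [← sq_abs (W 0 x), ← sq_abs (W 1 x)]
            have h3 : 0 ≤ ε ^ k * (1 + L) := by positivity
            nlinarith [mul_nonneg h3 (sq_nonneg (|W 0 x| - |W 1 x|)),
              mul_nonneg ht (sq_nonneg |W 1 x|), mul_nonneg h3 (sq_nonneg |W 0 x|)]
        _ ≤ a / 2 * W 0 x ^ 2 + 1 / 2 * W 1 x ^ 2 := by
            have := mul_le_mul_of_nonneg_right hε2 (sq_nonneg (W 0 x))
            have := mul_le_mul_of_nonneg_right hε1 (by positivity : 0 ≤ 1 / 2 * W 1 x ^ 2)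
            linarith)
  rw [intervalIntegral.integral_add (j0.const_mul _) (j1.const_mul _),
    intervalIntegral.integral_const_mul, intervalIntegral.integral_const_mul, ← energy,
    ← energy] at hNL
  have hs1 := sum_energy_ge hL W (j := 1) le_rfl hl
  have hwt := mul_le_mul_of_nonneg_left (hW.energy_zero_le_weighted hL) ha.le
  have hc : 0 < 2 * (1 + L) / a := by positivity
  have hy := hW.integral_weight_mul_le hL hf hc
  have e1 := energy_nonneg hL W 1
  have hfin : a / 4 * energy L W 0 ≤
      (1 + L) / 2 * (2 * (1 + L) / a) * ∫ x in 0..L, (f₁ - f₂) x ^ 2 := by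
    have : (1 + L) / 2 * (2 * (1 + L) / a)⁻¹ = a / 4 := by field_simp; norm_num
    have h5 : (1 + L) / 2 * ((2 * (1 + L) / a)⁻¹ * energy L W 0) = a / 4 * energy L W 0 := by
      rw [← this]; ring
    linarith
  calc energy L W 0 = 4 / a * (a / 4 * energy L W 0) := by field_simp
    _ ≤ 4 / a * ((1 + L) / 2 * (2 * (1 + L) / a) * ∫ x in 0..L, (f₁ - f₂) x ^ 2) := by gcongr
    _ = (2 * (1 + L) / a) ^ 2 * ∫ x in 0..L, (f₁ - f₂) x ^ 2 := by ring

end Nonlinear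

end IsAdmissible

/-! ### First order linear systems with two-point boundary conditions -/

section LinearSystem

variable {L : ℝ}

theorem L2.memLp (g : L2 L) : MemLp g 2 (volume.restrict (Set.Ioo (0 : ℝ) L)) := Lp.memLp g

theorem L2.norm_sq (hL : 0 ≤ L) (g : L2 L) : ‖g‖ ^ 2 = ∫ x in 0..L, g x ^ 2 := by
  rw [← real_inner_self_eq_norm_sq, L2.inner_def, intervalIntegral_eq_setIntegral_Ioo hL]
  simp [sq]

theorem L2.integrable_indicator (g : L2 L) : Integrable ((Set.Ioo 0 L).indicator g) volume :=
  (integrable_indicator_iff measurableSet_Ioo).2 ((L2.memLp g).integrable (by norm_num))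

/-- The primitive `x ↦ ∫₀ˣ g` of `g ∈ L²(0,L)`; extending `g` by zero makes it continuous on the
whole line. -/
noncomputable def L2.primitive : L2 L →ₗ[ℝ] (ℝ → ℝ) where
  toFun g x := ∫ t in 0..x, (Set.Ioo 0 L).indicator g t
  map_add' g h := by
    funext x
    rw [Pi.add_apply, ← intervalIntegral.integral_add
      (L2.integrable_indicator g).intervalIntegrable (L2.integrable_indicator h).intervalIntegrable]
    refine intervalIntegral.integral_congr_ae ?_
    filter_upwards [(ae_restrict_iff' measurableSet_Ioo).1 (Lp.coeFn_add g h)] with t ht _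
    by_cases hm : t ∈ Set.Ioo 0 L
    · simp only [Set.indicator_of_mem hm]
      exact ht hm
    · simp [hm]
  map_smul' c g := by
    funext x
    rw [RingHom.id_apply, Pi.smul_apply, smul_eq_mul, ← intervalIntegral.integral_const_mul]
    refine intervalIntegral.integral_congr_ae ?_
    filter_upwards [(ae_restrict_iff' measurableSet_Ioo).1 (Lp.coeFn_smul c g)] with t ht _
    by_cases hm : t ∈ Set.Ioo 0 L
    · simp [hm, ht hm]
    · simp [hm]

theorem L2.continuous_primitive (g : L2 L) : Continuous (L2.primitive g) :=
  intervalIntegral.continuous_primitive (fun _ _ => (L2.integrable_indicator g).intervalIntegrable)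
    0

theorem L2.primitive_zero_right (g : L2 L) : L2.primitive g 0 = 0 :=
  intervalIntegral.integral_same

theorem L2.isPrim_primitive (hL : 0 ≤ L) (g : L2 L) : IsPrim L (L2.primitive g) g :=
  (IsPrim.of_integral hL (L2.integrable_indicator g).intervalIntegrable).congr_ae (by
    filter_upwards [ae_restrict_mem measurableSet_Ioo] with x hx using Set.indicator_of_mem hx _)

theorem L2.abs_primitive_le (hL : 0 ≤ L) (g : L2 L) {x : ℝ} (hx : x ∈ Set.Icc 0 L) :
    |L2.primitive g x| ≤ Real.sqrt L * ‖g‖ := by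
  have h0 : L2.primitive g x = ∫ t in 0..x, g t := by
    rw [(L2.isPrim_primitive hL g).integral_eq_of_mem hL hx, L2.primitive_zero_right, sub_zero]
  have hsub : Set.uIcc 0 x ⊆ Set.uIcc 0 L := by
    rw [Set.uIcc_of_le hL, Set.uIcc_of_le hx.1]
    exact Set.Icc_subset_Icc_right hx.2
  have hg := (L2.memLp g).intervalIntegrable_Ioo hL
  have hgg := (L2.memLp g).intervalIntegrable_sq_Ioo hL
  have h1 := sq_intervalIntegral_mul_le (f := fun _ => 1) (g := g) hx.1
    (by simp) (by simpa using hg.mono_set hsub) (hgg.mono_set hsub)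
  have h2 : ∫ t in 0..x, g t ^ 2 ≤ ‖g‖ ^ 2 := by
    rw [L2.norm_sq hL]
    exact intervalIntegral.integral_mono_interval le_rfl hx.1 hx.2
      (Filter.Eventually.of_forall fun t => sq_nonneg _) hgg
  have h3 : 0 ≤ ∫ t in 0..x, g t ^ 2 :=
    intervalIntegral.integral_nonneg hx.1 fun _ _ => sq_nonneg _
  refine abs_le_of_sq_le_sq ?_ (by positivity)
  rw [h0, mul_pow, Real.sq_sqrt hL]
  simp only [one_mul, one_pow, intervalIntegral.integral_const, sub_zero, smul_eq_mul,
    mul_one] at h1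
  exact h1.trans (mul_le_mul hx.2 h2 h3 hL)

variable {E : Type*} [NormedAddCommGroup E] [NormedSpace ℝ E] [CompleteSpace E]

theorem exp_smul_apply_exp_neg_smul (M : E →L[ℝ] E) (x : ℝ) (v : E) :
    NormedSpace.exp (x • M) (NormedSpace.exp ((-x) • M) v) = v := by
  have h : NormedSpace.exp (x • M) * NormedSpace.exp ((-x) • M) = 1 := by
    let : NormedAlgebra ℚ (E →L[ℝ] E) := NormedAlgebra.restrictScalars ℚ ℝ _
    rw [← NormedSpace.exp_add_of_commute (((Commute.refl M).smul_left x).smul_right (-x)),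
      neg_smul, add_neg_cancel, NormedSpace.exp_zero]
  exact DFunLike.congr_fun h v

theorem continuous_exp_smul (M : E →L[ℝ] E) :
    Continuous fun x : ℝ => NormedSpace.exp (x • M) :=
  continuous_iff_continuousAt.2 fun x => (hasDerivAt_exp_smul_const M x).continuousAt

/-- If the homogeneous boundary value problem `Y' = M Y`, `T (Y 0, Y L) = 0` has only the trivial
solution, then `Y' = M Y + g e`, `T (Y 0, Y L) = 0` is solvable for all `g ∈ L²(0,L)`, and the
solution depends linearly and boundedly on `g`. -/
theorem exists_linear_twoPoint_solution [FiniteDimensional ℝ E] (hL : 0 ≤ L) (M : E →L[ℝ] E)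
    (e : E) (T : E × E →ₗ[ℝ] E)
    (hT : ∀ y : E, T (y, NormedSpace.exp (L • M) y) = 0 → y = 0) :
    ∃ (Y : L2 L →ₗ[ℝ] (ℝ → E)) (C : ℝ), 0 ≤ C ∧ ∀ g : L2 L,
      (∀ φ : E →L[ℝ] ℝ,
        IsPrim L (fun x => φ (Y g x)) (fun x => φ (M (Y g x)) + g x * φ e)) ∧
      T (Y g 0, Y g L) = 0 ∧ ∀ x ∈ Set.Icc 0 L, ‖Y g x‖ ≤ C * ‖g‖ := by
  have hexpc := continuous_exp_smul M
  -- With `V = ∫₀ˣ g`, the function `Z = Y - V e` solves `Z' = M Z + V M e`, whose right-hand side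
  -- is continuous. Duhamel's formula gives `Z x = exp (x M) (Z 0 + J x)`.
  have hJc : ∀ g : L2 L, Continuous
      (fun s => L2.primitive g s • NormedSpace.exp ((-s) • M) (M e)) := fun g =>
    (L2.continuous_primitive g).smul ((hexpc.comp continuous_neg).clm_apply continuous_const)
  let J : L2 L →ₗ[ℝ] (ℝ → E) :=
    { toFun := fun g x => ∫ s in 0..x, L2.primitive g s • NormedSpace.exp ((-s) • M) (M e)
      map_add' := fun g h => by
        funext x
        rw [Pi.add_apply, ← intervalIntegral.integral_add ((hJc g).intervalIntegrable _ _)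
          ((hJc h).intervalIntegrable _ _)]
        simp only [map_add, Pi.add_apply, add_smul]
      map_smul' := fun c g => by
        funext x
        rw [RingHom.id_apply, Pi.smul_apply, ← intervalIntegral.integral_smul]
        simp only [map_smul, Pi.smul_apply, smul_eq_mul, mul_smul] }
  let B : E →ₗ[ℝ] E := T.comp (LinearMap.id.prod (NormedSpace.exp (L • M) : E →L[ℝ] E).toLinearMap)
  have hB : Function.Injective B := (injective_iff_map_eq_zero B).2 fun y hy => hT y hy
  let R := (LinearEquiv.ofInjectiveEndo B hB).symm
  have hBR : ∀ v, B (R v) = v := fun v => (LinearEquiv.ofInjectiveEndo B hB).apply_symm_apply v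
  let w : L2 L → E := fun g => NormedSpace.exp (L • M) (J g L) + L2.primitive g L • e
  let Q : E →L[ℝ] E :=
    LinearMap.toContinuousLinearMap (-(R.toLinearMap.comp (T.comp (LinearMap.inr ℝ E E))))
  have hQ : ∀ v, B (Q v) = -T (0, v) := by
    intro v
    change B (-(R (T (0, v)))) = _
    rw [map_neg, hBR]
  let Y : L2 L →ₗ[ℝ] (ℝ → E) :=
    { toFun := fun g x => NormedSpace.exp (x • M) (Q (w g) + J g x) + L2.primitive g x • e
      map_add' := fun g h => by
        funext x
        simp only [w, map_add, Pi.add_apply, add_smul]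
        abel
      map_smul' := fun c g => by
        funext x
        simp only [w, map_smul, map_add, Pi.smul_apply, smul_add, RingHom.id_apply, smul_assoc] }
  obtain ⟨K, hK⟩ := (isCompact_Icc (a := -L) (b := L)).exists_bound_of_continuousOn
    hexpc.continuousOn
  have hK0 : 0 ≤ K := (norm_nonneg _).trans (hK 0 ⟨by linarith, hL⟩)
  set c := Real.sqrt L with hc
  have hc0 : 0 ≤ c := Real.sqrt_nonneg _
  have hJb : ∀ g : L2 L, ∀ x ∈ Set.Icc 0 L, ‖J g x‖ ≤ c * (K * ‖M e‖) * L * ‖g‖ := by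
    intro g x hx
    have h := intervalIntegral.norm_integral_le_of_norm_le_const (a := 0) (b := x)
      (f := fun s => L2.primitive g s • NormedSpace.exp ((-s) • M) (M e))
      (C := c * ‖g‖ * (K * ‖M e‖)) (by
        intro s hs
        rw [Set.uIoc_of_le hx.1] at hs
        rw [norm_smul, Real.norm_eq_abs]
        refine mul_le_mul (L2.abs_primitive_le hL g ⟨hs.1.le, hs.2.trans hx.2⟩) ?_
          (norm_nonneg _) (by positivity)
        refine (ContinuousLinearMap.le_opNorm _ _).trans ?_
        gcongr
        exact hK _ ⟨by linarith [hs.2, hx.2], by linarith [hs.1]⟩)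
    rw [sub_zero, abs_of_nonneg hx.1] at h
    calc ‖J g x‖ ≤ c * ‖g‖ * (K * ‖M e‖) * x := h
      _ ≤ c * ‖g‖ * (K * ‖M e‖) * L := by gcongr; exact hx.2
      _ = _ := by ring
  have hVb : ∀ g : L2 L, ∀ x ∈ Set.Icc 0 L, ‖L2.primitive g x • e‖ ≤ c * ‖e‖ * ‖g‖ := by
    intro g x hx
    rw [norm_smul, Real.norm_eq_abs]
    calc |L2.primitive g x| * ‖e‖ ≤ c * ‖g‖ * ‖e‖ := by
          gcongr; exact L2.abs_primitive_le hL g hx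
      _ = _ := by ring
  set c₁ := c * (K * ‖M e‖) * L with hc₁
  set c₂ := c * ‖e‖ with hc₂
  have hc₁0 : 0 ≤ c₁ := by positivity
  have hc₂0 : 0 ≤ c₂ := by positivity
  have hexpb : ∀ x ∈ Set.Icc 0 L, ∀ v, ‖NormedSpace.exp (x • M) v‖ ≤ K * ‖v‖ := by
    intro x hx v
    refine (ContinuousLinearMap.le_opNorm _ _).trans ?_
    gcongr
    exact hK _ ⟨by linarith [hx.1], hx.2⟩
  have hwb : ∀ g : L2 L, ‖Q (w g)‖ ≤ ‖Q‖ * ((K * c₁ + c₂) * ‖g‖) := by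
    intro g
    have hLm : L ∈ Set.Icc 0 L := ⟨hL, le_rfl⟩
    refine (Q.le_opNorm _).trans ?_
    gcongr
    refine (norm_add_le _ _).trans ?_
    have h1 := (hexpb L hLm (J g L)).trans (mul_le_mul_of_nonneg_left (hJb g L hLm) hK0)
    have h2 := hVb g L hLm
    linarith
  refine ⟨Y, K * (‖Q‖ * (K * c₁ + c₂) + c₁) + c₂, by positivity, fun g => ⟨fun φ => ?_, ?_, ?_⟩⟩
  · have hZ : ∀ x, HasDerivAt (fun x => NormedSpace.exp (x • M) (Q (w g) + J g x))
        (M (Y g x)) x := by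
      intro x
      have hJ : HasDerivAt (J g) (L2.primitive g x • NormedSpace.exp ((-x) • M) (M e)) x :=
        intervalIntegral.integral_hasDerivAt_right ((hJc g).intervalIntegrable _ _)
          ((hJc g).stronglyMeasurableAtFilter _ _) (hJc g).continuousAt
      have h := (hasDerivAt_exp_smul_const' M x).clm_apply (hJ.const_add (Q (w g)))
      convert h using 1
      change M (NormedSpace.exp (x • M) (Q (w g) + J g x) + L2.primitive g x • e) = _
      rw [map_smul, exp_smul_apply_exp_neg_smul, map_add, map_smul]
      rfl
    have hYc : Continuous (Y g) :=
      (continuous_iff_continuousAt.2 fun x => (hZ x).continuousAt).add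
        ((L2.continuous_primitive g).smul continuous_const)
    have h1 : IsPrim L (fun x => φ (NormedSpace.exp (x • M) (Q (w g) + J g x)))
        (fun x => φ (M (Y g x))) :=
      IsPrim.of_hasDerivAt (fun x => φ.hasFDerivAt.comp_hasDerivAt x (hZ x))
        (φ.continuous.comp (M.continuous.comp hYc))
    have h2 := h1.add ((L2.isPrim_primitive hL g).const_mul (φ e))
    convert h2 using 1
    · funext x
      change φ (NormedSpace.exp (x • M) (Q (w g) + J g x) + L2.primitive g x • e) = _
      rw [map_add, map_smul, smul_eq_mul, mul_comm (L2.primitive g x)]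
    · funext x
      rw [mul_comm]
  · have hY0 : Y g 0 = Q (w g) := by
      change NormedSpace.exp ((0 : ℝ) • M) (Q (w g) + ∫ s in 0..0, _) + L2.primitive g 0 • e = _
      rw [L2.primitive_zero_right, intervalIntegral.integral_same, zero_smul, zero_smul,
        NormedSpace.exp_zero, add_zero, add_zero]
      rfl
    have hYL : Y g L = NormedSpace.exp (L • M) (Q (w g)) + w g := by
      change NormedSpace.exp (L • M) (Q (w g) + J g L) + L2.primitive g L • e = _
      rw [map_add, add_assoc]
    have hsplit : T (Y g 0, Y g L) = B (Q (w g)) + T (0, w g) := by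
      change _ = T (Q (w g), NormedSpace.exp (L • M) (Q (w g))) + _
      rw [hY0, hYL, ← map_add, Prod.mk_add_mk, add_zero]
    rw [hsplit, hQ, neg_add_cancel]
  · intro x hx
    change ‖NormedSpace.exp (x • M) (Q (w g) + J g x) + L2.primitive g x • e‖ ≤ _
    have h1 := (hexpb x hx (Q (w g) + J g x)).trans (mul_le_mul_of_nonneg_left
      ((norm_add_le _ _).trans (add_le_add (hwb g) (hJb g x hx))) hK0)
    have h2 := (norm_add_le (NormedSpace.exp (x • M) (Q (w g) + J g x))
      (L2.primitive g x • e)).trans (add_le_add h1 (hVb g x hx))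
    refine h2.trans (le_of_eq ?_)
    ring

end LinearSystem

/-! ### The linear problem -/

section LinearProblem

variable {a L : ℝ} {l : ℕ}

/-- The phase space of the linear equation of order `2l+1`: the values of `u, Du, …, D^{2l}u`. -/
abbrev Phase (l : ℕ) : Type := Fin (2 * l + 1) → ℝ

/-- The coordinate of index `i ≤ 2l` on the phase space. -/
noncomputable def coord (l i : ℕ) : Phase l →L[ℝ] ℝ :=
  ContinuousLinearMap.proj (Fin.ofNat (2 * l + 1) i)

theorem phase_ext {y z : Phase l} (h : ∀ i ≤ 2 * l, coord l i y = coord l i z) : y = z := by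
  funext i
  have := h i (by omega)
  simpa [coord, Fin.ofNat_eq_cast] using this

/-- All terms of `a u + ∑ (-1)^{j+1} D^{2j+1}u` except the one of highest order. -/
noncomputable def lowerOrder (a : ℝ) (l : ℕ) : Phase l →L[ℝ] ℝ :=
  a • coord l 0 + ∑ j ∈ Finset.Icc 1 (l - 1), (-1 : ℝ) ^ (j + 1) • coord l (2 * j + 1)

/-- The matrix of the first order system equivalent to the homogeneous linear equation. -/
noncomputable def companion (a : ℝ) (l : ℕ) : Phase l →L[ℝ] Phase l :=
  ContinuousLinearMap.pi fun i =>
    if (i : ℕ) < 2 * l then coord l (i + 1) else (-1 : ℝ) ^ l • lowerOrder a l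

/-- The direction in which the right-hand side enters the first order system. -/
noncomputable def forcing (l : ℕ) : Phase l :=
  Pi.single (Fin.ofNat (2 * l + 1) (2 * l)) ((-1) ^ (l + 1))

/-- The `2l+1` boundary values `u(0), …, D^{l-1}u(0), u(L), …, Dˡu(L)`. -/
noncomputable def boundaryMap (l : ℕ) : Phase l × Phase l →ₗ[ℝ] Phase l :=
  LinearMap.pi fun i =>
    if (i : ℕ) < l then (coord l i).toLinearMap.comp (LinearMap.fst ℝ _ _)
    else (coord l (i - l)).toLinearMap.comp (LinearMap.snd ℝ _ _)

theorem coord_companion_of_lt {i : ℕ} (hi : i < 2 * l) (y : Phase l) :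
    coord l i (companion a l y) = coord l (i + 1) y := by
  have h : (Fin.ofNat (2 * l + 1) i : ℕ) = i := by
    simp [Nat.mod_eq_of_lt (by omega : i < 2 * l + 1)]
  simp only [coord, companion, ContinuousLinearMap.proj_apply, ContinuousLinearMap.pi_apply, h,
    if_pos hi]

theorem coord_companion_top (y : Phase l) :
    coord l (2 * l) (companion a l y) = (-1) ^ l * lowerOrder a l y := by
  change (companion a l y) (Fin.ofNat (2 * l + 1) (2 * l)) = _
  simp [companion, ContinuousLinearMap.pi_apply]

theorem coord_forcing_of_lt {i : ℕ} (hi : i < 2 * l) : coord l i (forcing l) = 0 := by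
  have h : (Fin.ofNat (2 * l + 1) i : ℕ) = i := by
    simp [Nat.mod_eq_of_lt (by omega : i < 2 * l + 1)]
  have h' : (Fin.ofNat (2 * l + 1) (2 * l) : ℕ) = 2 * l := by simp
  have hne : Fin.ofNat (2 * l + 1) i ≠ Fin.ofNat (2 * l + 1) (2 * l) := by
    intro he
    have := congrArg Fin.val he
    omega
  exact Pi.single_eq_of_ne hne _

theorem coord_forcing_top : coord l (2 * l) (forcing l) = (-1) ^ (l + 1) :=
  Pi.single_eq_same _ _

theorem coord_eq_zero_of_boundaryMap {p q : Phase l} (h : boundaryMap l (p, q) = 0) :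
    (∀ i < l, coord l i p = 0) ∧ ∀ i ≤ l, coord l i q = 0 := by
  constructor
  · intro i hi
    have h1 := congrFun h ⟨i, by omega⟩
    simpa [boundaryMap, hi] using h1
  · intro i hi
    have h1 := congrFun h ⟨i + l, by omega⟩
    simpa [boundaryMap] using h1

/-- The derivatives `u, …, D^{2l}u` read off from a solution `Y` of the first order system, and
`D^{2l+1}u` as given by the equation. -/
noncomputable def profile (a : ℝ) (l : ℕ) (Y : ℝ → Phase l) (g : ℝ → ℝ) (i : ℕ) (x : ℝ) : ℝ :=
  if i ≤ 2 * l then coord l i (Y x) else (-1) ^ (l + 1) * g x + (-1) ^ l * lowerOrder a l (Y x)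

theorem profile_of_le {Y : ℝ → Phase l} {g : ℝ → ℝ} {i : ℕ} (hi : i ≤ 2 * l) (x : ℝ) :
    profile a l Y g i x = coord l i (Y x) := if_pos hi

theorem profile_top (Y : ℝ → Phase l) (g : ℝ → ℝ) (x : ℝ) :
    profile a l Y g (2 * l + 1) x = (-1) ^ (l + 1) * g x + (-1) ^ l * lowerOrder a l (Y x) :=
  if_neg (by omega)

theorem profile_eqn (hl : 1 ≤ l) (Y : ℝ → Phase l) (g : ℝ → ℝ) (x : ℝ) :
    a * profile a l Y g 0 x + dispersion l (profile a l Y g) x = g x := by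
  have hs : dispersion l (profile a l Y g) x =
      ∑ j ∈ Finset.Icc 1 (l - 1), (-1) ^ (j + 1) * coord l (2 * j + 1) (Y x) +
        (-1) ^ (l + 1) * profile a l Y g (2 * l + 1) x := by
    obtain ⟨m, rfl⟩ : ∃ m, l = m + 1 := ⟨l - 1, by omega⟩
    rw [dispersion, Finset.sum_Icc_succ_top (by omega)]
    congr 1
    refine Finset.sum_congr rfl fun j hj => ?_
    have := (Finset.mem_Icc.1 hj).2
    rw [profile_of_le (by omega)]
  have hlow : lowerOrder a l (Y x) = a * coord l 0 (Y x) +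
      ∑ j ∈ Finset.Icc 1 (l - 1), (-1) ^ (j + 1) * coord l (2 * j + 1) (Y x) := by
    simp [lowerOrder]
  rw [hs, profile_top, profile_of_le (by omega), hlow]
  have h1 : ((-1 : ℝ) ^ l) ^ 2 = 1 := by rw [← pow_mul, mul_comm, pow_mul]; simp
  rw [pow_succ]
  linear_combination (g x - a * coord l 0 (Y x) -
    ∑ j ∈ Finset.Icc 1 (l - 1), (-1) ^ (j + 1) * coord l (2 * j + 1) (Y x)) * h1

theorem isAdmissible_profile {Y : ℝ → Phase l} {g : ℝ → ℝ}
    (hY : ∀ φ : Phase l →L[ℝ] ℝ, IsPrim L (fun x => φ (Y x))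
      (fun x => φ (companion a l (Y x)) + g x * φ (forcing l)))
    (hb : boundaryMap l (Y 0, Y L) = 0) : IsAdmissible L l (profile a l Y g) where
  prim i hi := by
    have h := hY (coord l i)
    have h0 : profile a l Y g i = fun x => coord l i (Y x) := funext fun x => profile_of_le hi x
    rw [h0]
    refine h.congr_ae (Filter.Eventually.of_forall fun x => ?_)
    rcases hi.lt_or_eq with hlt | rfl
    · rw [coord_companion_of_lt hlt, coord_forcing_of_lt hlt, mul_zero, add_zero,
        profile_of_le (by omega)]
    · rw [coord_companion_top, coord_forcing_top, profile_top]
      ring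
  left i hi := by
    rw [profile_of_le (by omega)]
    exact (coord_eq_zero_of_boundaryMap hb).1 i hi
  right i hi := by
    rw [profile_of_le (by omega)]
    exact (coord_eq_zero_of_boundaryMap hb).2 i hi

/-- The homogeneous linear problem has only the trivial solution: by the energy identity with
`ρ = 1`, `a ‖u‖² ≤ 0`. -/
theorem homogeneous_solution_eq_zero (ha : 0 < a) (hL : 0 < L) (hl : 1 ≤ l) (y : Phase l)
    (hy : boundaryMap l (y, NormedSpace.exp (L • companion a l) y) = 0) : y = 0 := by
  set M := companion a l with hM
  set Y : ℝ → Phase l := fun x => NormedSpace.exp (x • M) y with hYdef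
  have hd : ∀ x, HasDerivAt Y (M (Y x)) x := by
    intro x
    have h := (hasDerivAt_exp_smul_const' M x).clm_apply (hasDerivAt_const x y)
    rw [map_zero, add_zero] at h
    exact h
  have hYc : Continuous Y := continuous_iff_continuousAt.2 fun x => (hd x).continuousAt
  have hU : IsAdmissible L l (profile a l Y 0) := by
    refine isAdmissible_profile (fun φ => ?_) ?_
    · simp only [Pi.zero_apply, zero_mul, add_zero]
      exact IsPrim.of_hasDerivAt (fun x => φ.hasFDerivAt.comp_hasDerivAt x (hd x))
        (φ.continuous.comp (M.continuous.comp hYc))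
    · have h0 : Y 0 = y := by simp [hYdef]
      rw [h0]
      exact hy
  have hE : energy L (profile a l Y 0) 0 ≤ 0 := by
    have h := hU.energy_identity hL.le (a := a) (g := 0)
      (Filter.Eventually.of_forall fun x => profile_eqn hl Y 0 x) 1 0
    have hs : 0 ≤ ∑ j ∈ Finset.Icc 1 l, (1 / 2 : ℝ) * profile a l Y 0 j 0 ^ 2 :=
      Finset.sum_nonneg fun j _ => by positivity
    simp only [Pi.zero_apply, mul_zero, intervalIntegral.integral_zero, zero_mul, add_zero,
      one_mul, zero_add] at h
    rw [← energy] at h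
    nlinarith
  have hE0 := le_antisymm hE (energy_nonneg hL.le _ 0)
  have hzero : ∀ i ≤ 2 * l, ∀ x ∈ Set.Ioo 0 L, coord l i (Y x) = 0 := by
    intro i
    induction i with
    | zero =>
      intro _ x hx
      have h := hU.sq_sq_le hL.le hl (Set.Ioo_subset_Icc_self hx)
      rw [hE0, zero_mul, mul_zero, profile_of_le (by omega)] at h
      have h2 : (coord l 0 (Y x) ^ 2) ^ 2 = 0 := le_antisymm h (by positivity)
      simpa using h2
    | succ i ih =>
      intro hi x hx
      have h1 : HasDerivAt (fun x => coord l i (Y x)) (coord l i (M (Y x))) x :=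
        (coord l i).hasFDerivAt.comp_hasDerivAt x (hd x)
      have h2 : HasDerivAt (fun x => coord l i (Y x)) 0 x :=
        (hasDerivAt_const x (0 : ℝ)).congr_of_eventuallyEq
          (Filter.eventually_of_mem (isOpen_Ioo.mem_nhds hx) (ih (by omega)))
      rw [← coord_companion_of_lt (by omega)]
      exact h1.unique h2
  have hmid : Y (L / 2) = 0 := phase_ext fun i hi => by
    rw [map_zero]
    exact hzero i hi _ ⟨by linarith, by linarith⟩
  have := exp_smul_apply_exp_neg_smul M (-(L / 2)) y
  rw [neg_neg] at this
  rw [← this, show NormedSpace.exp ((L / 2) • M) y = 0 from hmid, map_zero]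

/-- The solution operator `S` of the linear problem, together with its bounds. -/
theorem exists_linear_solution (ha : 0 < a) (hL : 0 < L) (hl : 1 ≤ l) :
    ∃ (S : L2 L → ℕ → ℝ → ℝ) (C : ℝ), 0 ≤ C ∧
      (∀ g, IsAdmissible L l (S g)) ∧
      (∀ g x, a * S g 0 x + dispersion l (S g) x = g x) ∧
      (∀ g, ∀ i ≤ 2 * l, ∀ x ∈ Set.Icc 0 L, |S g i x| ≤ C * ‖g‖) ∧
      (∀ g, ∀ x ∈ Set.Icc 0 L, |S g (2 * l + 1) x| ≤ |g x| + C * ‖g‖) ∧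
      ∀ g h, ∀ i ≤ 2 * l, ∀ x, S (g - h) i x = S g i x - S h i x := by
  obtain ⟨Y, C, hC, hY⟩ := exists_linear_twoPoint_solution hL.le (companion a l) (forcing l)
    (boundaryMap l) (homogeneous_solution_eq_zero ha hL hl)
  refine ⟨fun g => profile a l (Y g) g, C + ‖lowerOrder a l‖ * C, by positivity,
    fun g => isAdmissible_profile (hY g).1 (hY g).2.1, fun g x => profile_eqn hl _ _ x,
    fun g i hi x hx => ?_, fun g x hx => ?_, fun g h i hi x => ?_⟩
  · simp only [profile_of_le hi]
    have h1 : |coord l i (Y g x)| ≤ ‖Y g x‖ := norm_le_pi_norm (Y g x) _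
    have h2 : 0 ≤ ‖lowerOrder a l‖ * C * ‖g‖ := by positivity
    linarith [(hY g).2.2 x hx]
  · simp only [profile_top]
    refine (abs_add_le _ _).trans ?_
    simp only [abs_mul, abs_pow, abs_neg, abs_one, one_pow, one_mul]
    have h1 : |lowerOrder a l (Y g x)| ≤ ‖lowerOrder a l‖ * (C * ‖g‖) :=
      ((lowerOrder a l).le_opNorm _).trans
        (mul_le_mul_of_nonneg_left ((hY g).2.2 x hx) (norm_nonneg _))
    have h2 : 0 ≤ C * ‖g‖ := by positivity
    linarith
  · simp only [profile_of_le hi, map_sub, Pi.sub_apply]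

end LinearProblem

/-! ### Weak derivatives on an interval -/

section Weak

variable {L : ℝ}

namespace IsTestFun

variable {φ ψ : ℝ → ℝ}

theorem deriv (hφ : IsTestFun L φ) : IsTestFun L (deriv φ) where
  smooth := (contDiff_infty_iff_deriv.1 hφ.smooth).2
  compact := hφ.compact.deriv
  supp := tsupport_deriv_subset.trans hφ.supp

theorem eq_zero_of_notMem (hφ : IsTestFun L φ) {x : ℝ} (hx : x ∉ Set.Ioo 0 L) : φ x = 0 :=
  image_eq_zero_of_notMem_tsupport fun h => hx (hφ.supp h)

theorem hasDerivAt (hφ : IsTestFun L φ) (x : ℝ) : HasDerivAt φ (_root_.deriv φ x) x :=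
  (hφ.smooth.differentiable (by simp) x).hasDerivAt

theorem isPrim (hφ : IsTestFun L φ) : IsPrim L φ (_root_.deriv φ) :=
  IsPrim.of_hasDerivAt hφ.hasDerivAt hφ.deriv.smooth.continuous

theorem integral_eq (hφ : IsTestFun L φ) : ∫ x in Set.Ioo 0 L, φ x = ∫ x, φ x :=
  setIntegral_eq_integral_of_forall_compl_eq_zero fun _ hx => hφ.eq_zero_of_notMem hx

theorem sub_const_mul (hφ : IsTestFun L φ) (hψ : IsTestFun L ψ) (c : ℝ) :
    IsTestFun L (fun x => φ x - c * ψ x) := by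
  have hsub : tsupport (fun x => φ x - c * ψ x) ⊆ tsupport φ ∪ tsupport ψ := by
    refine closure_minimal (fun x hx => ?_)
      ((isClosed_tsupport φ).union (isClosed_tsupport ψ))
    by_contra h
    rw [Set.mem_union, not_or] at h
    exact hx (by simp [image_eq_zero_of_notMem_tsupport h.1, image_eq_zero_of_notMem_tsupport h.2])
  exact ⟨hφ.smooth.sub (contDiff_const.mul hψ.smooth),
    (hφ.compact.isCompact.union hψ.compact.isCompact).of_isClosed_subset (isClosed_tsupport _) hsub,
    hsub.trans (Set.union_subset hφ.supp hψ.supp)⟩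

/-- A test function of integral zero has a primitive that is a test function. -/
theorem exists_deriv_eq (hL : 0 < L) (hφ : IsTestFun L φ) (h0 : ∫ x, φ x = 0) :
    ∃ Φ, IsTestFun L Φ ∧ _root_.deriv Φ = φ := by
  have hc := hφ.smooth.continuous
  have hKc : IsCompact (tsupport φ ∪ {L / 2}) := hφ.compact.isCompact.union isCompact_singleton
  have hKs : tsupport φ ∪ {L / 2} ⊆ Set.Ioo 0 L :=
    Set.union_subset hφ.supp (Set.singleton_subset_iff.2 ⟨by linarith, by linarith⟩)
  have hne : (tsupport φ ∪ {L / 2}).Nonempty := ⟨L / 2, Or.inr rfl⟩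
  obtain ⟨α, hαK, hα⟩ := hKc.exists_isLeast hne
  obtain ⟨β, hβK, hβ⟩ := hKc.exists_isGreatest hne
  have hlt : ∀ x < α, φ x = 0 := fun x hx =>
    image_eq_zero_of_notMem_tsupport fun h => absurd (hα (Or.inl h)) (not_le.2 hx)
  have hgt : ∀ x > β, φ x = 0 := fun x hx =>
    image_eq_zero_of_notMem_tsupport fun h => absurd (hβ (Or.inl h)) (not_le.2 hx)
  have hd : ∀ x, HasDerivAt (fun x => ∫ t in 0..x, φ t) (φ x) x := fun x =>
    intervalIntegral.integral_hasDerivAt_right (hc.intervalIntegrable _ _)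
      (hc.stronglyMeasurableAtFilter _ _) hc.continuousAt
  have hderiv : _root_.deriv (fun x => ∫ t in 0..x, φ t) = φ := funext fun x => (hd x).deriv
  have hsupp : tsupport (fun x => ∫ t in 0..x, φ t) ⊆ Set.Icc α β := by
    refine closure_minimal (fun x hx => ?_) isClosed_Icc
    by_contra hn
    rw [Set.mem_Icc, not_and_or, not_le, not_le] at hn
    refine hx ?_
    change ∫ t in 0..x, φ t = 0
    rcases hn with hn | hn
    · rw [intervalIntegral.integral_congr (g := fun _ => 0), intervalIntegral.integral_zero]
      intro t ht
      refine hlt t (lt_of_le_of_lt (Set.mem_Icc.1 ht).2 (max_lt (hKs hαK).1 hn))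
    · rw [intervalIntegral.integral_of_le ((hKs hβK).1.trans hn).le]
      refine (setIntegral_eq_integral_of_forall_compl_eq_zero fun t ht => ?_).trans h0
      rw [Set.mem_Ioc, not_and_or, not_lt, not_le] at ht
      rcases ht with ht | ht
      · exact hφ.eq_zero_of_notMem fun h => absurd h.1 (not_lt.2 ht)
      · exact hgt t (hn.trans ht)
  refine ⟨fun x => ∫ t in 0..x, φ t, ⟨?_, ?_, ?_⟩, hderiv⟩
  · rw [contDiff_infty_iff_deriv, hderiv]
    exact ⟨fun x => (hd x).differentiableAt, hφ.smooth⟩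
  · exact isCompact_Icc.of_isClosed_subset (isClosed_tsupport _) hsupp
  · exact hsupp.trans (Set.Icc_subset_Ioo (hKs hαK).1 (hKs hβK).2)

theorem exists_integral_eq_one (hL : 0 < L) : ∃ η, IsTestFun L η ∧ ∫ x, η x = 1 := by
  let b : ContDiffBump (L / 2) := ⟨L / 8, L / 4, by linarith, by linarith⟩
  refine ⟨b.normed volume, ⟨b.contDiff_normed, b.hasCompactSupport_normed, ?_⟩, b.integral_normed⟩
  rw [b.tsupport_normed_eq, Real.closedBall_eq_Icc]
  refine Set.Icc_subset_Ioo ?_ ?_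
  · change 0 < L / 2 - L / 4
    linarith
  · change L / 2 + L / 4 < L
    linarith

theorem integrableOn_mul (hφ : IsTestFun L φ) {w : ℝ → ℝ} (hw : IntegrableOn w (Set.Ioo 0 L)) :
    IntegrableOn (fun x => w x * φ x) (Set.Ioo 0 L) := by
  obtain ⟨M, hM⟩ := hφ.compact.exists_bound_of_continuous hφ.smooth.continuous
  exact hw.mul_bdd (c := M) hφ.smooth.continuous.aestronglyMeasurable
    (Filter.Eventually.of_forall hM)

end IsTestFun

/-- The lemma of du Bois-Reymond: a function with vanishing weak derivative is constant. -/
theorem ae_eq_const_of_integral_deriv_eq_zero (hL : 0 < L) {w : ℝ → ℝ}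
    (hw : IntegrableOn w (Set.Ioo 0 L))
    (h : ∀ φ, IsTestFun L φ → ∫ x in Set.Ioo 0 L, w x * deriv φ x = 0) :
    ∃ c, ∀ᵐ x ∂volume.restrict (Set.Ioo (0 : ℝ) L), w x = c := by
  obtain ⟨η, hη, hη1⟩ := IsTestFun.exists_integral_eq_one hL
  set c := ∫ x in Set.Ioo 0 L, w x * η x with hc
  have key : ∀ᵐ x ∂volume, x ∈ Set.Ioo (0 : ℝ) L → w x - c = 0 := by
    have hconst : IntegrableOn (fun _ : ℝ => c) (Set.Ioo 0 L) := integrableOn_const (by simp)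
    refine isOpen_Ioo.ae_eq_zero_of_integral_contDiff_smul_eq_zero
      (f := fun x => w x - c) (hw.sub hconst).locallyIntegrableOn ?_
    intro ψ hψs hψc hψ0
    have hψ : IsTestFun L ψ := ⟨hψs, hψc, hψ0⟩
    have hi : ∀ {φ : ℝ → ℝ}, IsTestFun L φ → Integrable φ volume := fun hφ =>
      hφ.smooth.continuous.integrable_of_hasCompactSupport hφ.compact
    obtain ⟨Φ, hΦ, hΦd⟩ := (hψ.sub_const_mul hη (∫ x, ψ x)).exists_deriv_eq hL (by
      rw [integral_sub (hi hψ) ((hi hη).const_mul _), integral_const_mul, hη1, mul_one, sub_self])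
    have h1 := h Φ hΦ
    rw [hΦd] at h1
    have e1 : (fun x => w x * (ψ x - (∫ x, ψ x) * η x)) =
        fun x => w x * ψ x - (∫ x, ψ x) * (w x * η x) := by funext x; ring
    rw [e1, integral_sub (hψ.integrableOn_mul hw) ((hη.integrableOn_mul hw).const_mul _),
      integral_const_mul, ← hc, ← hψ.integral_eq] at h1
    have e2 : ∫ x in Set.Ioo 0 L, ψ x • (w x - c) = 0 := by
      have : (fun x => ψ x • (w x - c)) = fun x => w x * ψ x - c * ψ x := by
        funext x; simp only [smul_eq_mul]; ring
      rw [this, integral_sub (hψ.integrableOn_mul hw) ((hi hψ).integrableOn.const_mul c),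
        integral_const_mul]
      linarith
    rw [← e2]
    refine (setIntegral_eq_integral_of_forall_compl_eq_zero fun x hx => ?_).symm
    rw [hψ.eq_zero_of_notMem hx, zero_smul]
  refine ⟨c, ?_⟩
  filter_upwards [(ae_restrict_iff' measurableSet_Ioo).2 key] with x hx
  linarith

theorem IsPrim.integral_mul_deriv_test (hL : 0 ≤ L) {F f φ : ℝ → ℝ} (hF : IsPrim L F f)
    (hφ : IsTestFun L φ) :
    ∫ x in Set.Ioo 0 L, F x * _root_.deriv φ x = -∫ x in Set.Ioo 0 L, f x * φ x := by
  have h := (hF.mul hφ.isPrim).integral_eq hL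
  rw [hφ.eq_zero_of_notMem (x := 0) (by simp), hφ.eq_zero_of_notMem (x := L) (by simp),
    intervalIntegral.integral_add
      ((hF.intervalIntegrable hL).mul_continuousOn hφ.isPrim.continuousOn_uIcc)
      ((hφ.isPrim.intervalIntegrable hL).continuousOn_mul hF.continuousOn_uIcc),
    intervalIntegral_eq_setIntegral_Ioo hL, intervalIntegral_eq_setIntegral_Ioo hL] at h
  linarith

theorem IsWeakDeriv.refl (u : L2 L) : IsWeakDeriv L 0 u u := fun φ _ => by simp

/-- Consecutive weak derivatives satisfy the defining relation of a first weak derivative. -/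
theorem IsWeakDeriv.integral_mul_deriv {n : ℕ} {u v w : L2 L} (hv : IsWeakDeriv L n u v)
    (hw : IsWeakDeriv L (n + 1) u w) {φ : ℝ → ℝ} (hφ : IsTestFun L φ) :
    ∫ x in Set.Ioo 0 L, v x * deriv φ x = -∫ x in Set.Ioo 0 L, w x * φ x := by
  have h1 := hv (deriv φ) hφ.deriv
  have h2 := hw φ hφ
  rw [iteratedDeriv_succ', h1, pow_succ] at h2
  have := mul_left_cancel₀ (pow_ne_zero n (by norm_num : (-1 : ℝ) ≠ 0)) (h2.trans (mul_assoc _ _ _))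
  linarith

theorem IsWeakDeriv.exists_ae_eq_primitive (hL : 0 < L) {n : ℕ} {u v w : L2 L}
    (hv : IsWeakDeriv L n u v) (hw : IsWeakDeriv L (n + 1) u w) :
    ∃ c, ∀ᵐ x ∂volume.restrict (Set.Ioo (0 : ℝ) L), v x = c + L2.primitive w x := by
  have hvi : IntegrableOn (fun x => v x) (Set.Ioo 0 L) := (L2.memLp v).integrable (by norm_num)
  have hpi : IntegrableOn (fun x => L2.primitive w x) (Set.Ioo 0 L) :=
    (L2.continuous_primitive w).integrableOn_Icc.mono_set Set.Ioo_subset_Icc_self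
  obtain ⟨c, hc⟩ := ae_eq_const_of_integral_deriv_eq_zero hL (w := fun x => v x - L2.primitive w x)
    (hvi.sub hpi) (fun φ hφ => by
      simp only [sub_mul]
      rw [integral_sub (hφ.deriv.integrableOn_mul hvi) (hφ.deriv.integrableOn_mul hpi),
        hv.integral_mul_deriv hw hφ, (L2.isPrim_primitive hL.le w).integral_mul_deriv_test hL.le hφ,
        sub_self])
  refine ⟨c, ?_⟩
  filter_upwards [hc] with x hx
  linarith

/-- The successive classical derivatives are weak derivatives. -/
theorem isWeakDeriv_of_isPrim (hL : 0 ≤ L) {m : ℕ} {U : ℕ → ℝ → ℝ} {v : ℕ → L2 L}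
    (hU : ∀ i < m, IsPrim L (U i) (U (i + 1)))
    (hv : ∀ i ≤ m, ∀ᵐ x ∂volume.restrict (Set.Ioo (0 : ℝ) L), v i x = U i x) {i : ℕ} (hi : i ≤ m) :
    IsWeakDeriv L i (v 0) (v i) := by
  induction i with
  | zero => exact IsWeakDeriv.refl _
  | succ i ih =>
    intro φ hφ
    have h1 := ih (by omega) (deriv φ) hφ.deriv
    have e1 : ∫ x in Set.Ioo 0 L, v i x * deriv φ x = ∫ x in Set.Ioo 0 L, U i x * deriv φ x :=
      integral_congr_ae (by filter_upwards [hv i (by omega)] with x hx; rw [hx])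
    have e2 : ∫ x in Set.Ioo 0 L, v (i + 1) x * φ x = ∫ x in Set.Ioo 0 L, U (i + 1) x * φ x :=
      integral_congr_ae (by filter_upwards [hv (i + 1) hi] with x hx; rw [hx])
    rw [iteratedDeriv_succ', h1, e1, (hU i (by omega)).integral_mul_deriv_test hL hφ, e2, pow_succ]
    ring

theorem HasValueAt.eq_of_continuousOn (hL : 0 < L) {v : L2 L} {p c : ℝ} (h : HasValueAt L v p c)
    (hp : p ∈ Set.Icc 0 L) {F : ℝ → ℝ} (hF : ContinuousOn F (Set.Icc 0 L))
    (hvF : ∀ᵐ x ∂volume.restrict (Set.Ioo (0 : ℝ) L), v x = F x) : F p = c := by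
  obtain ⟨g, hg, hvg, rfl⟩ := h
  refine Measure.eqOn_Icc_of_ae_eq volume hL.ne ?_ hF hg hp
  rw [← restrict_Ioo_eq_restrict_Icc]
  filter_upwards [hvF, hvg] with x h1 h2
  rw [← h1, h2]

/-! ### Regular solutions in terms of absolutely continuous functions -/

variable {a : ℝ} {l k : ℕ} {f u : L2 L}

theorem IsRegularSolution.exists_isAdmissible (hL : 0 < L) (hl : 1 ≤ l)
    (h : IsRegularSolution a L l k f u) :
    ∃ U : ℕ → ℝ → ℝ, IsAdmissible L l U ∧
      (∀ᵐ x ∂volume.restrict (Set.Ioo (0 : ℝ) L), u x = U 0 x) ∧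
      ∀ᵐ x ∂volume.restrict (Set.Ioo (0 : ℝ) L),
        a * U 0 x + dispersion l U x + U 0 x ^ k * U 1 x = f x := by
  have hwd : ∀ i ≤ 2 * l + 1, IsWeakDeriv L i u (weakDeriv L i u) := by
    intro i hi
    obtain ⟨v, hv⟩ := h.mem i hi
    rwa [hv.weakDeriv_eq]
  have hc : ∀ i, ∃ c, i ≤ 2 * l → ∀ᵐ x ∂volume.restrict (Set.Ioo (0 : ℝ) L),
      weakDeriv L i u x = c + L2.primitive (weakDeriv L (i + 1) u) x := by
    intro i
    by_cases hi : i ≤ 2 * l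
    · obtain ⟨c, hc⟩ := (hwd i (by omega)).exists_ae_eq_primitive hL (hwd (i + 1) (by omega))
      exact ⟨c, fun _ => hc⟩
    · exact ⟨0, fun h => absurd h hi⟩
  choose c hc using hc
  set U : ℕ → ℝ → ℝ := fun i x =>
    if i ≤ 2 * l then c i + L2.primitive (weakDeriv L (i + 1) u) x else weakDeriv L i u x with hU
  have hUv : ∀ i, ∀ᵐ x ∂volume.restrict (Set.Ioo (0 : ℝ) L), weakDeriv L i u x = U i x := by
    intro i
    by_cases hi : i ≤ 2 * l
    · filter_upwards [hc i hi] with x hx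
      simp only [hU, if_pos hi, hx]
    · refine Filter.Eventually.of_forall fun x => ?_
      simp only [hU, if_neg hi]
  have hprim : ∀ i ≤ 2 * l, IsPrim L (U i) (U (i + 1)) := by
    intro i hi
    have h1 := ((IsPrim.const (L := L) (c i)).add
      (L2.isPrim_primitive hL.le (weakDeriv L (i + 1) u))).congr_ae (g := U (i + 1)) (by
        filter_upwards [hUv (i + 1)] with x hx
        rw [zero_add, hx])
    convert h1 using 1
    funext x
    simp only [hU, if_pos hi]
  have hu0 : weakDeriv L 0 u = u := (IsWeakDeriv.refl u).weakDeriv_eq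
  have hcont : ∀ i ≤ 2 * l, ContinuousOn (U i) (Set.Icc 0 L) := fun i hi =>
    (hprim i hi).continuousOn hL.le
  refine ⟨U, ⟨hprim, fun i hi => ?_, fun i hi => ?_⟩, ?_, ?_⟩
  · exact (h.left i hi).eq_of_continuousOn hL ⟨le_rfl, hL.le⟩ (hcont i (by omega)) (hUv i)
  · rcases hi.lt_or_eq with hlt | rfl
    · exact (h.right i hlt).eq_of_continuousOn hL ⟨hL.le, le_rfl⟩ (hcont i (by omega)) (hUv i)
    · exact h.right_top.eq_of_continuousOn hL ⟨hL.le, le_rfl⟩ (hcont i (by omega)) (hUv i)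
  · simpa only [hu0] using hUv 0
  · filter_upwards [h.eqn, ae_all_iff.2 hUv] with x hx hall
    have h0 : u x = U 0 x := by rw [← hall 0, hu0]
    rw [h0] at hx
    simpa only [dispersion, ← hall 1, ← hall (2 * _ + 1)] using hx

theorem IsAdmissible.memLp (hL : 0 < L) {U : ℕ → ℝ → ℝ} (hU : IsAdmissible L l U) {i : ℕ}
    (hi : i ≤ 2 * l) : MemLp (U i) 2 (volume.restrict (Set.Ioo (0 : ℝ) L)) := by
  obtain ⟨C, hC⟩ := (hU.prim i hi).exists_bound hL.le
  refine MemLp.of_bound ?_ C ?_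
  · exact (((hU.prim i hi).continuousOn hL.le).mono Set.Ioo_subset_Icc_self).aestronglyMeasurable
      measurableSet_Ioo
  · filter_upwards [ae_restrict_mem measurableSet_Ioo] with x hx
    exact hC x (Set.Ioo_subset_Icc_self hx)

theorem IsAdmissible.isRegularSolution (hL : 0 < L) {U : ℕ → ℝ → ℝ} (hU : IsAdmissible L l U)
    (htop : MemLp (U (2 * l + 1)) 2 (volume.restrict (Set.Ioo (0 : ℝ) L)))
    (hu : ∀ᵐ x ∂volume.restrict (Set.Ioo (0 : ℝ) L), u x = U 0 x) (hl : 1 ≤ l)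
    (heq : ∀ᵐ x ∂volume.restrict (Set.Ioo (0 : ℝ) L),
      a * U 0 x + dispersion l U x + U 0 x ^ k * U 1 x = f x) :
    IsRegularSolution a L l k f u ∧
      ∀ i ≤ 2 * l + 1, ∀ᵐ x ∂volume.restrict (Set.Ioo (0 : ℝ) L),
        weakDeriv L i u x = U i x := by
  have hmem : ∀ i ≤ 2 * l + 1, MemLp (U i) 2 (volume.restrict (Set.Ioo (0 : ℝ) L)) := by
    intro i hi
    rcases hi.lt_or_eq with hlt | rfl
    · exact hU.memLp hL (by omega)
    · exact htop
  have hex : ∀ i, ∃ v : L2 L, i ≤ 2 * l + 1 →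
      ∀ᵐ x ∂volume.restrict (Set.Ioo (0 : ℝ) L), v x = U i x := by
    intro i
    by_cases hi : i ≤ 2 * l + 1
    · exact ⟨(hmem i hi).toLp _, fun _ => (hmem i hi).coeFn_toLp⟩
    · exact ⟨0, fun h => absurd h hi⟩
  choose v hv using hex
  have hv0 : v 0 = u := Lp.ext (by
    filter_upwards [hv 0 (by omega), hu] with x h1 h2
    rw [h1, h2])
  have hwd : ∀ i ≤ 2 * l + 1, IsWeakDeriv L i u (v i) := fun i hi =>
    hv0 ▸ isWeakDeriv_of_isPrim hL.le (fun i hi => hU.prim i (by omega)) hv hi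
  have hwv : ∀ i ≤ 2 * l + 1, ∀ᵐ x ∂volume.restrict (Set.Ioo (0 : ℝ) L),
      weakDeriv L i u x = U i x := fun i hi => by
    rw [(hwd i hi).weakDeriv_eq]
    exact hv i hi
  have hval : ∀ i ≤ 2 * l, ∀ p c, U i p = c → HasValueAt L (weakDeriv L i u) p c :=
    fun i hi p c hp => ⟨U i, (hU.prim i hi).continuousOn hL.le, hwv i (by omega), hp⟩
  refine ⟨⟨fun i hi => ⟨v i, hwd i hi⟩, ?_, fun i hi => hval i (by omega) 0 0 (hU.left i hi),
    fun i hi => hval i (by omega) L 0 (hU.right i hi.le),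
    hval l (by omega) L 0 (hU.right l le_rfl)⟩, hwv⟩
  have hall : ∀ᵐ x ∂volume.restrict (Set.Ioo (0 : ℝ) L), ∀ i, i ≤ 2 * l + 1 →
      weakDeriv L i u x = U i x := ae_all_iff.2 fun i => by
    by_cases hi : i ≤ 2 * l + 1
    · filter_upwards [hwv i hi] with x hx _ using hx
    · exact Filter.Eventually.of_forall fun x h => absurd h hi
  filter_upwards [heq, hu, hall] with x hx h0 hw
  rw [h0, hw 1 (by omega), ← hx, dispersion]
  congr 2
  refine Finset.sum_congr rfl fun j hj => ?_
  rw [hw _ (by have := (Finset.mem_Icc.1 hj).2; omega)]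

end Weak

/-! ### The nonlinear problem -/

section NonlinearProblem

variable {L : ℝ}

theorem L2.norm_sq_le_of_ae (hL : 0 ≤ L) {v : L2 L} {b : ℝ → ℝ}
    (hb : IntervalIntegrable b volume 0 L)
    (h : ∀ᵐ x ∂volume.restrict (Set.Ioo (0 : ℝ) L), v x ^ 2 ≤ b x) :
    ‖v‖ ^ 2 ≤ ∫ x in 0..L, b x := by
  rw [L2.norm_sq hL]
  exact integral_mono_of_ae hL ((L2.memLp v).intervalIntegrable_sq_Ioo hL) hb h

theorem L2.norm_le_of_ae_abs_le (hL : 0 ≤ L) {v : L2 L} {c : ℝ} (hc : 0 ≤ c)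
    (h : ∀ᵐ x ∂volume.restrict (Set.Ioo (0 : ℝ) L), |v x| ≤ c) : ‖v‖ ≤ Real.sqrt L * c := by
  refine le_of_sq_le_sq ?_ (by positivity)
  have h1 := L2.norm_sq_le_of_ae hL (v := v) (b := fun _ => c ^ 2) (by simp) (by
    filter_upwards [h] with x hx
    exact sq_le_sq' (by linarith [(abs_le.1 hx).1]) (abs_le.1 hx).2)
  rw [mul_pow, Real.sq_sqrt hL]
  simpa using h1

theorem L2.norm_sub_sq (hL : 0 ≤ L) (f g : L2 L) :
    ‖f - g‖ ^ 2 = ∫ x in 0..L, (f x - g x) ^ 2 := by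
  rw [L2.norm_sq hL]
  refine integral_congr_of_ae hL ?_
  filter_upwards [Lp.coeFn_sub f g] with x hx
  rw [hx, Pi.sub_apply]

theorem norm_sq_le_weightedSq (hL : 0 ≤ L) (f : L2 L) : ‖f‖ ^ 2 ≤ weightedSq L f := by
  have hc : ContinuousOn (fun x : ℝ => 1 + x) (Set.uIcc 0 L) := by fun_prop
  rw [weightedSq, ← intervalIntegral_eq_setIntegral_Ioo hL]
  refine L2.norm_sq_le_of_ae hL
    (((L2.memLp f).intervalIntegrable_sq_Ioo hL).continuousOn_mul hc) ?_
  filter_upwards [ae_restrict_mem measurableSet_Ioo] with x hx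
  nlinarith [hx.1, sq_nonneg (f x)]

/-- Solvability of `g + N g = f` for small `f`, by the contraction principle on a small ball. -/
theorem exists_add_eq_of_lipschitz_ball {X : Type*} [NormedAddCommGroup X] [CompleteSpace X]
    {N : X → X} {r : ℝ} (h0 : N 0 = 0)
    (hN : ∀ g h, ‖g‖ ≤ r → ‖h‖ ≤ r → ‖N g - N h‖ ≤ 1 / 2 * ‖g - h‖) {f : X} (hf : ‖f‖ ≤ r / 2) :
    ∃ g, ‖g‖ ≤ r ∧ g + N g = f ∧ ‖g‖ ≤ 2 * ‖f‖ := by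
  have hr : 0 ≤ r := by linarith [norm_nonneg f]
  have hN0 : ∀ g, ‖g‖ ≤ r → ‖N g‖ ≤ 1 / 2 * ‖g‖ := fun g hg => by
    simpa [h0] using hN g 0 hg (by simpa using hr)
  have hmaps : Set.MapsTo (fun g => f - N g) (Metric.closedBall 0 r) (Metric.closedBall 0 r) := by
    intro g hg
    rw [mem_closedBall_zero_iff] at hg ⊢
    exact (norm_sub_le _ _).trans (by linarith [hN0 g hg])
  have hcon : ContractingWith (1 / 2 : NNReal)
      (hmaps.restrict (fun g => f - N g) (Metric.closedBall 0 r) (Metric.closedBall 0 r)) := by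
    refine ⟨by norm_num, LipschitzWith.of_dist_le_mul fun g h => ?_⟩
    have hg := mem_closedBall_zero_iff.1 g.2
    have hh := mem_closedBall_zero_iff.1 h.2
    rw [Subtype.dist_eq, Subtype.dist_eq, dist_eq_norm, dist_eq_norm]
    change ‖f - N g - (f - N h)‖ ≤ _
    rw [sub_sub_sub_cancel_left, norm_sub_rev]
    simpa using hN g h hg hh
  obtain ⟨g, hgr, hg, -⟩ := ContractingWith.exists_fixedPoint' Metric.isClosed_closedBall.isComplete
    hmaps hcon (Metric.mem_closedBall_self hr) (edist_ne_top _ _)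
  rw [mem_closedBall_zero_iff] at hgr
  have hg' : g + N g = f := by
    have : f - N g = g := hg
    rw [← sub_eq_iff_eq_add.1 this]
  refine ⟨g, hgr, hg', ?_⟩
  have h1 : ‖g‖ ≤ ‖f‖ + ‖N g‖ := by
    rw [← hg']
    simpa using norm_sub_le (g + N g) (N g)
  linarith [hN0 g hgr]

theorem abs_pow_mul_sub_le {p q p' q' m d : ℝ} (k : ℕ) (hk : 1 ≤ k) (hp : |p| ≤ m) (hp' : |p'| ≤ m)
    (hq' : |q'| ≤ m) (hpd : |p - p'| ≤ d) (hqd : |q - q'| ≤ d) :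
    |p ^ k * q - p' ^ k * q'| ≤ (k + 1) * m ^ k * d := by
  have hm : 0 ≤ m := (abs_nonneg _).trans hp
  have hd : 0 ≤ d := (abs_nonneg _).trans hpd
  have h1 : |p ^ k - p' ^ k| ≤ d * k * m ^ (k - 1) := by
    refine (abs_pow_sub_pow_le p p' k).trans ?_
    gcongr
    exact max_le hp hp'
  calc |p ^ k * q - p' ^ k * q'| = |p ^ k * (q - q') + (p ^ k - p' ^ k) * q'| := by ring_nf
    _ ≤ |p| ^ k * |q - q'| + |p ^ k - p' ^ k| * |q'| := by
        refine (abs_add_le _ _).trans ?_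
        rw [abs_mul, abs_mul, abs_pow]
    _ ≤ m ^ k * d + d * k * m ^ (k - 1) * m := by gcongr
    _ = m ^ k * d + d * k * m ^ (k - 1 + 1) := by rw [pow_succ]; ring
    _ = (k + 1) * m ^ k * d := by rw [Nat.sub_add_cancel hk]; ring

variable {a : ℝ} {l k : ℕ}

/-- Existence of a small regular solution for small data. -/
theorem exists_regularSolution (ha : 0 < a) (hL : 0 < L) (hl : 1 ≤ l) (hk : 1 ≤ k) :
    ∃ r > 0, ∃ K > 0, ∀ f : L2 L, ‖f‖ ≤ r →
      ∃ u : L2 L, IsRegularSolution a L l k f u ∧ normH L (2 * l + 1) u ≤ K * ‖f‖ := by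
  obtain ⟨S, C, hC, hadm, heqn, hb, hbtop, hsub⟩ := exists_linear_solution ha hL hl
  have hmem : ∀ g, MemLp (fun x => S g 0 x ^ k * S g 1 x) 2
      (volume.restrict (Set.Ioo (0 : ℝ) L)) := by
    intro g
    have c : ∀ i ≤ 2 * l, ContinuousOn (S g i) (Set.Icc 0 L) := fun i hi =>
      ((hadm g).prim i hi).continuousOn hL.le
    refine MemLp.of_bound ((((c 0 (by omega)).pow k).mul (c 1 (by omega))).mono
      Set.Ioo_subset_Icc_self |>.aestronglyMeasurable measurableSet_Ioo)
      ((C * ‖g‖) ^ k * (C * ‖g‖)) ?_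
    filter_upwards [ae_restrict_mem measurableSet_Ioo] with x hx
    have hx' := Set.Ioo_subset_Icc_self hx
    rw [Real.norm_eq_abs, abs_mul, abs_pow]
    gcongr
    · exact hb g 0 (by omega) x hx'
    · exact hb g 1 (by omega) x hx'
  let N : L2 L → L2 L := fun g => (hmem g).toLp _
  have hNae : ∀ g, ∀ᵐ x ∂volume.restrict (Set.Ioo (0 : ℝ) L), N g x = S g 0 x ^ k * S g 1 x :=
    fun g => (hmem g).coeFn_toLp
  -- `N` has Lipschitz constant at most `√L (k+1) C (C r)ᵏ` on the ball of radius `r`;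
  -- `r = 1/D` makes this at most `1/2`.
  set D := 2 * (1 + Real.sqrt L) * (k + 1) * (C + 1) ^ 2 with hD
  have hs0 : 0 ≤ Real.sqrt L := Real.sqrt_nonneg L
  have hD0 : 0 < D := by positivity
  have hNlip : ∀ g h, ‖g‖ ≤ 1 / D → ‖h‖ ≤ 1 / D → ‖N g - N h‖ ≤ 1 / 2 * ‖g - h‖ := by
    intro g h hg hh
    set m := C * (1 / D) with hm
    have hm0 : 0 ≤ m := by positivity
    have hbd : ∀ g : L2 L, ‖g‖ ≤ 1 / D → ∀ i ≤ 2 * l, ∀ x ∈ Set.Icc 0 L, |S g i x| ≤ m :=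
      fun g hg i hi x hx => (hb g i hi x hx).trans (mul_le_mul_of_nonneg_left hg hC)
    have hbs : ∀ i ≤ 2 * l, ∀ x ∈ Set.Icc 0 L, |S g i x - S h i x| ≤ C * ‖g - h‖ := by
      intro i hi x hx
      rw [← hsub g h i hi x]
      exact hb (g - h) i hi x hx
    have h1 : ‖N g - N h‖ ≤ Real.sqrt L * ((k + 1) * m ^ k * (C * ‖g - h‖)) := by
      refine L2.norm_le_of_ae_abs_le hL.le (by positivity) ?_
      filter_upwards [Lp.coeFn_sub (N g) (N h), hNae g, hNae h,
        ae_restrict_mem measurableSet_Ioo] with x e1 e2 e3 hx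
      have hx' := Set.Ioo_subset_Icc_self hx
      rw [e1, Pi.sub_apply, e2, e3]
      exact abs_pow_mul_sub_le k hk (hbd g hg 0 (by omega) x hx') (hbd h hh 0 (by omega) x hx')
        (hbd h hh 1 (by omega) x hx') (hbs 0 (by omega) x hx') (hbs 1 (by omega) x hx')
    have hCD : 2 * (Real.sqrt L * (k + 1) * C * C) ≤ D := by
      have : Real.sqrt L * (k + 1) * (C * C) ≤ (1 + Real.sqrt L) * (k + 1) * (C + 1) ^ 2 := by
        gcongr
        · linarith
        · nlinarith
      rw [hD]
      linarith
    have hm1 : m ≤ 1 := by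
      rw [hm, mul_one_div, div_le_one hD0, hD]
      have h2 : (1 : ℝ) ≤ 2 * (1 + Real.sqrt L) * (k + 1) := by
        have : (0 : ℝ) ≤ k := Nat.cast_nonneg k
        nlinarith
      nlinarith [mul_le_mul_of_nonneg_right h2 (sq_nonneg (C + 1))]
    have hmk : m ^ k ≤ m := pow_le_of_le_one hm0 hm1 (by omega)
    refine h1.trans ?_
    calc Real.sqrt L * ((k + 1) * m ^ k * (C * ‖g - h‖))
        ≤ Real.sqrt L * ((k + 1) * m * (C * ‖g - h‖)) := by gcongr
      _ = (2 * (Real.sqrt L * (k + 1) * C * C)) / D * (1 / 2 * ‖g - h‖) := by rw [hm]; ring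
      _ ≤ 1 * (1 / 2 * ‖g - h‖) := by
          gcongr
          exact (div_le_one hD0).2 hCD
      _ = _ := one_mul _
  have hN0 : N 0 = 0 := by
    refine Lp.ext ?_
    filter_upwards [hNae 0, Lp.coeFn_zero ℝ 2 (volume.restrict (Set.Ioo (0 : ℝ) L)),
      ae_restrict_mem measurableSet_Ioo] with x e1 e2 hx
    have h1 := hb 0 1 (by omega) x (Set.Ioo_subset_Icc_self hx)
    rw [norm_zero, mul_zero] at h1
    rw [e1, e2, abs_nonpos_iff.1 h1, mul_zero, Pi.zero_apply]
  set B := 2 + 2 * C ^ 2 * L with hB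
  have hB0 : 0 < B := by positivity
  set K := Real.sqrt ((2 * l + 2) * B * 4) with hK
  refine ⟨1 / D / 2, by positivity, K, Real.sqrt_pos.2 (by positivity), fun f hf => ?_⟩
  obtain ⟨g, -, hg, hgf⟩ := exists_add_eq_of_lipschitz_ball hN0 hNlip hf
  have htop : MemLp (S g (2 * l + 1)) 2 (volume.restrict (Set.Ioo (0 : ℝ) L)) := by
    refine ((L2.memLp g).abs.add (memLp_const (C * ‖g‖))).mono' ?_ ?_
    · exact ((intervalIntegrable_iff_Ioo hL.le _).1
        ((hadm g).intervalIntegrable hL.le le_rfl)).aestronglyMeasurable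
    · filter_upwards [ae_restrict_mem measurableSet_Ioo] with x hx
      exact hbtop g x (Set.Ioo_subset_Icc_self hx)
  have hu := ((hadm g).memLp hL (i := 0) (by omega)).coeFn_toLp
  obtain ⟨hsol, hwd⟩ := (hadm g).isRegularSolution hL (a := a) (k := k) (f := f) htop hu hl (by
    filter_upwards [hNae g, Lp.coeFn_add g (N g)] with x e1 e2
    rw [heqn, ← e1, ← hg, e2, Pi.add_apply])
  set u : L2 L := ((hadm g).memLp hL (i := 0) (by omega)).toLp _ with hudef
  refine ⟨u, hsol, ?_⟩
  have hnorm : ∀ i ∈ Finset.range (2 * l + 1 + 1), ‖weakDeriv L i u‖ ^ 2 ≤ B * ‖g‖ ^ 2 := by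
    intro i hi
    have hi' : i ≤ 2 * l + 1 := by have := Finset.mem_range.1 hi; omega
    have hgi := ((L2.memLp g).intervalIntegrable_sq_Ioo hL.le).const_mul 2
    have hci : IntervalIntegrable (fun _ : ℝ => 2 * (C * ‖g‖) ^ 2) volume 0 L := by simp
    have h1 := L2.norm_sq_le_of_ae hL.le (v := weakDeriv L i u)
      (b := fun x => 2 * g x ^ 2 + 2 * (C * ‖g‖) ^ 2) (hgi.add hci) (by
        filter_upwards [hwd i hi', ae_restrict_mem measurableSet_Ioo] with x hx hxm
        have hx' := Set.Ioo_subset_Icc_self hxm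
        have h2 : |weakDeriv L i u x| ≤ |g x| + C * ‖g‖ := by
          rw [hx]
          rcases hi'.lt_or_eq with hlt | rfl
          · exact (hb g i (by omega) x hx').trans (by linarith [abs_nonneg (g x)])
          · exact hbtop g x hx'
        have h3 : |weakDeriv L i u x| ^ 2 ≤ (|g x| + C * ‖g‖) ^ 2 :=
          pow_le_pow_left₀ (abs_nonneg _) h2 2
        rw [sq_abs] at h3
        rw [← sq_abs (g x)]
        nlinarith [sq_nonneg (|g x| - C * ‖g‖)])
    rw [intervalIntegral.integral_add hgi hci, intervalIntegral.integral_const_mul,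
      ← L2.norm_sq hL.le, intervalIntegral.integral_const, sub_zero, smul_eq_mul] at h1
    refine h1.trans (le_of_eq ?_)
    rw [hB]
    ring
  have hgf2 : ‖g‖ ^ 2 ≤ 4 * ‖f‖ ^ 2 := by
    have := pow_le_pow_left₀ (norm_nonneg g) hgf 2
    linarith [mul_pow (2 : ℝ) ‖f‖ 2]
  have hKf : K * ‖f‖ = Real.sqrt ((2 * l + 2) * B * 4 * ‖f‖ ^ 2) := by
    rw [Real.sqrt_mul (by positivity), Real.sqrt_sq (norm_nonneg f)]
  rw [hKf, normH]
  refine Real.sqrt_le_sqrt ?_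
  calc ∑ i ∈ Finset.range (2 * l + 1 + 1), ‖weakDeriv L i u‖ ^ 2
      ≤ ∑ _i ∈ Finset.range (2 * l + 1 + 1), B * ‖g‖ ^ 2 := Finset.sum_le_sum hnorm
    _ = (2 * l + 2) * B * ‖g‖ ^ 2 := by
        rw [Finset.sum_const, Finset.card_range, nsmul_eq_mul]
        push_cast
        ring
    _ ≤ (2 * l + 2) * B * (4 * ‖f‖ ^ 2) := by gcongr
    _ = _ := by ring

/-- Regular solutions with small right-hand sides depend Lipschitz continuously on them. -/
theorem exists_norm_sub_le (ha : 0 < a) (hL : 0 < L) (hl : 1 ≤ l) (hk : 1 ≤ k)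
    (hkl : k ≤ 4 * l) :
    ∃ δ > 0, ∃ C > 0, ∀ f₁ f₂ u₁ u₂ : L2 L, ‖f₁‖ ^ 2 < δ → ‖f₂‖ ^ 2 < δ →
      IsRegularSolution a L l k f₁ u₁ → IsRegularSolution a L l k f₂ u₂ →
      ‖u₁ - u₂‖ ≤ C * ‖f₁ - f₂‖ := by
  set A := 2 * ((3 + L) * (1 + 1 / a ^ 2)) with hA
  have hA0 : 0 < A := by positivity
  set ε := min 1 (min 1 (a / 2) / (2 + L)) with hε
  have hε0 : 0 < ε := by positivity
  have hεk : ε ^ k * (2 + L) ≤ min 1 (a / 2) := by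
    have h1 : ε ^ k ≤ ε := pow_le_of_le_one hε0.le (min_le_left _ _) (by omega)
    exact (le_div_iff₀ (by positivity)).1 (h1.trans (min_le_right _ _))
  refine ⟨min (a ^ 2 / 4) (ε ^ 2 / A), by positivity, 2 * (1 + L) / a, by positivity,
    fun f₁ f₂ u₁ u₂ hf₁ hf₂ h₁ h₂ => ?_⟩
  have hsmall : ∀ {f u : L2 L}, ‖f‖ ^ 2 < min (a ^ 2 / 4) (ε ^ 2 / A) →
      IsRegularSolution a L l k f u → ∃ U : ℕ → ℝ → ℝ, IsAdmissible L l U ∧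
      (∀ᵐ x ∂volume.restrict (Set.Ioo (0 : ℝ) L), u x = U 0 x) ∧
      (∀ᵐ x ∂volume.restrict (Set.Ioo (0 : ℝ) L),
        a * U 0 x + dispersion l U x + U 0 x ^ k * U 1 x = f x) ∧
      ∀ x ∈ Set.Icc 0 L, |U 0 x| ≤ ε := by
    intro f u hf h
    obtain ⟨U, hU, hu, heq⟩ := h.exists_isAdmissible hL hl
    refine ⟨U, hU, hu, heq, fun x hx => ?_⟩
    have h1 := hf.trans_le (min_le_left _ _)
    have h2 := hf.trans_le (min_le_right _ _)
    rw [lt_div_iff₀ hA0] at h2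
    rw [L2.norm_sq hL.le] at h1 h2
    have h3 := hU.sq_le_of_small ha hL.le hl hkl (L2.memLp f) heq (by linarith) hx
    exact abs_le_of_sq_le_sq (by linarith) hε0.le
  obtain ⟨U, hU, hu, heqU, hUε⟩ := hsmall hf₁ h₁
  obtain ⟨V, hV, hv, heqV, hVε⟩ := hsmall hf₂ h₂
  have h := hU.energy_sub_le ha hL.le hl hV (L2.memLp f₁) (L2.memLp f₂) heqU heqV hUε hVε
    (hεk.trans (min_le_left _ _)) (hεk.trans (min_le_right _ _))
  refine le_of_sq_le_sq ?_ (by positivity)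
  rw [mul_pow, L2.norm_sub_sq hL.le, L2.norm_sub_sq hL.le]
  refine le_trans (le_of_eq (integral_congr_of_ae hL.le ?_)) h
  filter_upwards [hu, hv] with x h1 h2
  rw [h1, h2]

end NonlinearProblem

theorem theorem2 (l k : ℕ) (hl : 1 ≤ l) (hk : 1 ≤ k) (hkl : k ≤ 4 * l)
    (a L : ℝ) (ha : 0 < a) (hL : 0 < L) :
    ∃ δ > 0, ∃ K > 0, ∃ C > 0,
      (∀ f : L2 L, weightedSq L f < δ →
        ∃ u : L2 L, IsRegularSolution a L l k f u ∧
          normH L (2 * l + 1) u ≤ K * Real.sqrt (weightedSq L f) ∧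
          ∀ v : L2 L, IsRegularSolution a L l k f v → v = u) ∧
      (∀ f₁ f₂ u₁ u₂ : L2 L, weightedSq L f₁ < δ → weightedSq L f₂ < δ →
        IsRegularSolution a L l k f₁ u₁ → IsRegularSolution a L l k f₂ u₂ →
        ‖u₁ - u₂‖ ≤ C * ‖f₁ - f₂‖) := by
  obtain ⟨r, hr, K, hK, hex⟩ := exists_regularSolution (k := k) ha hL hl hk
  obtain ⟨δ, hδ, C, hC, hdep⟩ := exists_norm_sub_le ha hL hl hk hkl
  have hw := norm_sq_le_weightedSq hL.le
  refine ⟨min δ (r ^ 2), by positivity, K, hK, C, hC, fun f hf => ?_,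
    fun f₁ f₂ u₁ u₂ hf₁ hf₂ => hdep f₁ f₂ u₁ u₂
      ((hw f₁).trans_lt (hf₁.trans_le (min_le_left _ _)))
      ((hw f₂).trans_lt (hf₂.trans_le (min_le_left _ _)))⟩
  have hfδ := (hw f).trans_lt (hf.trans_le (min_le_left _ _))
  have hfr : ‖f‖ ≤ r :=
    le_of_sq_le_sq ((hw f).trans (hf.trans_le (min_le_right _ _)).le) hr.le
  obtain ⟨u, hu, hun⟩ := hex f hfr
  refine ⟨u, hu, hun.trans ?_, fun v hv => ?_⟩
  · gcongr
    exact Real.le_sqrt_of_sq_le (hw f)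
  · have h := hdep f f v u hfδ hfδ hv hu
    rw [sub_self, norm_zero, mul_zero] at h
    exact sub_eq_zero.1 (norm_le_zero_iff.1 h)
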